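/- **Growth Theorem.** A *string* is a finite sequence of digits $0,1,2$. For a string $A$ let $A_0=A$ and let $A_{n}$ be obtained from $A_{n-1}$ by one look-and-say step in base 3: every maximal run of $k$ equal digits $d$ is replaced by the base-3 numeral of $k$ followed by $d$ (so $2221\mapsto 10\,2\,1\,1$). A string $S$ *splits as the concatenation* $P^{(1)}.P^{(2)}.\cdots.P^{(r)}$ if $S_n=P^{(1)}_nP^{(2)}_n\cdots P^{(r)}_n$ for all $n\ge 0$. The *neutrinos* are the strings $22$, $11110$, $11112$; the *fermions* are $E=10$, $M=1110$, $D=2110$, $B=22110$, $U=110$, $S=122110$, $T=222110$, $C=11222110$. The polynomial $x^3-x-1$ has exactly one real root $\lambda$, and $\lambda=1.3247\ldots$, that is, $1.3247\le\lambda<1.3248$. Let $\Lambda$ be the $8\times 8$ matrix, with rows and columns indexed by $E,M,D,B,U,S,T,C$ in this order, $$\Lambda=\begin{pmatrix}0&1&0&0&0&0&1&0\\1&0&0&0&0&0&0&0\\0&0&0&0&1&0&0&1\\0&0&0&0&0&0&1&1\\0&1&0&0&0&0&0&0\\0&0&1&0&0&0&0&0\\0&0&0&1&0&0&0&0\\0&0&0&0&0&1&0&0\end{pmatrix}.$$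 It is the fermion transition matrix: for each fermion $Q$, the string $Q_1$ splits as a concatenation of fermions in which each fermion $P$ occurs exactly $\Lambda_{P,Q}$ times. The number $\lambda$ is the Perron–Frobenius eigenvalue of $\Lambda$: it is positive, has an eigenvector with positive entries, is a simple root of the characteristic polynomial of $\Lambda$, and every other complex eigenvalue of $\Lambda$ has absolute value strictly less than $\lambda$. For every string $A$ such that no iterate $A_k$ ($k\ge 0$) splits as a concatenation of neutrinos (the empty string counting as the concatenation of zero neutrinos), $$\lim_{n\to\infty}\frac{\operatorname{Length}(A_n)}{\operatorname{Length}(A_{n-1})}=\lambda .$$ -/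

import Mathlib

namespace LookAndSay

/-- A base-3 string: a finite, possibly empty, sequence of digits `0, 1, 2`. -/
abbrev Str := List (Fin 3)

/-- The maximal runs of a string, from left to right, as pairs (length, digit). -/
def runs : Str → List (ℕ × Fin 3)
  | [] => []
  | a :: l =>
    match runs l with
    | [] => [(1, a)]
    | (k, b) :: t => if a = b then (k + 1, b) :: t else (1, a) :: (k, b) :: t

/-- The base-3 numeral of `n`, most significant digit first. -/
def base3 (n : ℕ) : Str := (Nat.digits 3 n).reverse.map (Fin.ofNat 3)

/-- One look-and-say step in base 3: each maximal run of `k` copies of the digit `d`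
is replaced by the base-3 numeral of `k` followed by `d`. -/
def say (A : Str) : Str := (runs A).flatMap fun r => base3 r.1 ++ [r.2]

/-- The `n`-th iterate `A_n` of `A` under the look-and-say step, with `A_0 = A`. -/
def iter (A : Str) (n : ℕ) : Str := say^[n] A

/-- `A` splits as the concatenation of the strings in the list `P`: for every `n` (so also
for `n = 0`) the `n`-th iterate of `A` is the concatenation of the `n`-th iterates of the
members of `P`, in order. -/
def SplitsAs (A : Str) (P : List Str) : Prop :=
  ∀ n : ℕ, iter A n = (P.map fun B => iter B n).flatten

/-- The three neutrinos `22`, `11110`, `11112`. -/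
def neutrinos : List Str := [[2, 2], [1, 1, 1, 1, 0], [1, 1, 1, 1, 2]]

/-- `A` splits as a concatenation of finitely many (possibly no) neutrinos. -/
def SplitsIntoNeutrinos (A : Str) : Prop :=
  ∃ P : List Str, (∀ B ∈ P, B ∈ neutrinos) ∧ SplitsAs A P

/-- The eight fermions, in the order E, M, D, B, U, S, T, C. -/
def fermion : Fin 8 → Str :=
  ![[1, 0],
    [1, 1, 1, 0],
    [2, 1, 1, 0],
    [2, 2, 1, 1, 0],
    [1, 1, 0],
    [1, 2, 2, 1, 1, 0],
    [2, 2, 2, 1, 1, 0],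
    [1, 1, 2, 2, 2, 1, 1, 0]]

/-- The fermion transition matrix, with rows and columns in the order of `fermion`: the
entry `(i, j)` is the number of fermions `i` that fermion `j` produces in one step. -/
def transitionMatrix : Matrix (Fin 8) (Fin 8) ℕ :=
  !![0, 1, 0, 0, 0, 0, 1, 0;
     1, 0, 0, 0, 0, 0, 0, 0;
     0, 0, 0, 0, 1, 0, 0, 1;
     0, 0, 0, 0, 0, 0, 1, 1;
     0, 1, 0, 0, 0, 0, 0, 0;
     0, 0, 1, 0, 0, 0, 0, 0;
     0, 0, 0, 1, 0, 0, 0, 0;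
     0, 0, 0, 0, 0, 1, 0, 0]

/-- `T` records the one-step decay of the fermions: the first iterate of each fermion `j`
splits as a concatenation of fermions in which fermion `i` occurs exactly `T i j` times. -/
def IsFermionTransitionMatrix (T : Matrix (Fin 8) (Fin 8) ℕ) : Prop :=
  ∀ j : Fin 8, ∃ w : List (Fin 8),
    SplitsAs (say (fermion j)) (w.map fermion) ∧ ∀ i : Fin 8, w.count i = T i j

/-- `r` is the Perron-Frobenius eigenvalue of the square matrix `M`: it is positive, it has
an eigenvector with positive entries, it is a simple root of the characteristic polynomial,
and every other complex eigenvalue has strictly smaller modulus. -/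
def IsPerronFrobeniusEigenvalue {m : ℕ} (M : Matrix (Fin m) (Fin m) ℝ) (r : ℝ) : Prop :=
  0 < r ∧
  (∃ v : Fin m → ℝ, (∀ i, 0 < v i) ∧ M.mulVec v = r • v) ∧
  M.charpoly.rootMultiplicity r = 1 ∧
  ∀ z : ℂ, Module.End.HasEigenvalue (Matrix.toLin' (M.map Complex.ofReal)) z →
    z ≠ (r : ℂ) → ‖z‖ < r

end LookAndSay

/-!
A string splits after each `0` that ends a run, because the numerals that a step writes at the
front of the right part never start with `0` (`iter_append_of_zero`). The proof shows that every
string decays: some iterate splits into neutrinos and into strings whose lengths grow like a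
positive multiple of `ρ ^ n`, where `ρ` is the real root of `x ^ 3 - x - 1` (`decays`). If no
iterate splits into neutrinos alone, at least one growing string is present, and the ratio of
consecutive lengths tends to `ρ`.

Growth of the fermions. Splitting at zeros turns the lengths of the iterates of the fermions into
a linear recurrence with characteristic polynomial `(x ^ 3 - x - 1) * (x ^ 5 - x ^ 3 + 1)`. After
division by `ρ ^ n`, the second factor is a contraction: the absolute values of its coefficients
add up to less than `1`. So is a multiple of the cofactor of `x - ρ` in the first factor. The
limit therefore exists, and it is positive since a positive combination of the terms is conserved
up to the factor `ρ` (`tendsto_of_contraction`, `exists_hasRate_of_padovan`, `grows_E`). Further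
strings grow because they reproduce themselves periodically and emit fermions
(`grows_of_period`).

Decay of every string. A run of length `k` is replaced by about `log k` digits, so that after
finitely many steps the runs of `0`, `1`, `2` have length at most `1`, `4`, `3`
(`exists_iter_hBound`). In this range, a string starting with `1111` has `1` as first digit for
ever, so that one can split before each run of four ones; such a run then turns into a neutrino
`11110` or `11112`, or disappears (`decays_1111_append`). There remain strings whose runs have
length at most three.
A zero-free factor of an iterate can be read backwards, digit pair by digit pair, as a factor of
the previous iterate (`exists_decode_of_infix`). Only finitely many zero-free words can be read
backwards three times without producing a run of length four: they have fewer than 19 digits. So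
after three steps the pieces between zeros belong to a finite list, and each of them is seen to
decay by direct computation (`decays_of_gBound`).
-/

namespace LookAndSay

open Filter Topology

/-! ### Runs, numerals and the look-and-say step -/

theorem runs_cons_head {c : Fin 3} {R : Str} : ∃ k t, runs (c :: R) = (k, c) :: t := by
  rw [runs]
  split
  · exact ⟨_, _, rfl⟩
  · split
    · next h => subst h; exact ⟨_, _, rfl⟩
    · exact ⟨_, _, rfl⟩

theorem runs_append {L R : Str} (h : ∀ x ∈ L.getLast?, x ∉ R.head?) :
    runs (L ++ R) = runs L ++ runs R := by
  induction L with
  | nil => simp [runs]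
  | cons a l ih =>
    cases l with
    | nil =>
      cases R with
      | nil => simp [runs]
      | cons c R =>
        have hac : a ≠ c := by
          intro hac
          exact h a (by simp) (by simp [hac])
        obtain ⟨k, t, ht⟩ := @runs_cons_head c R
        rw [List.singleton_append, runs, ht]
        simp [runs, hac]
    | cons b l =>
      have ih := ih (by simpa using h)
      obtain ⟨k, t, ht⟩ := @runs_cons_head b l
      rw [List.cons_append, runs, ih, ht, runs, ht]
      simp only [List.cons_append]
      split <;> simp

theorem runs_replicate (k : ℕ) (d : Fin 3) : runs (List.replicate (k + 1) d) = [(k + 1, d)] := by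
  induction k with
  | zero => simp [runs]
  | succ k ih => rw [List.replicate_succ, runs, ih]; simp

theorem runs_run {d : Fin 3} {B : Str} (k : ℕ) (h : d ∉ B.head?) :
    runs (List.replicate (k + 1) d ++ B) = (k + 1, d) :: runs B := by
  rw [runs_append, runs_replicate]
  · simp
  · intro x hx
    have : x = d := by simpa [List.getLast?_replicate, eq_comm] using hx
    exact this ▸ h

theorem say_append {L R : Str} (h : ∀ x ∈ L.getLast?, x ∉ R.head?) :
    say (L ++ R) = say L ++ say R := by
  simp [say, runs_append h]

theorem say_run {d : Fin 3} {B : Str} (k : ℕ) (h : d ∉ B.head?) :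
    say (List.replicate (k + 1) d ++ B) = base3 (k + 1) ++ d :: say B := by
  simp [say, runs_run k h]

@[simp] theorem say_nil : say [] = [] := rfl

/-- Induction on the number of maximal runs of a string. -/
theorem run_induction {P : Str → Prop} (nil : P [])
    (run : ∀ (k : ℕ) (d : Fin 3) (B : Str), d ∉ B.head? → P B →
      P (List.replicate (k + 1) d ++ B)) (A : Str) : P A := by
  suffices H : ∀ A : Str, P A ∧ ∀ a, a ∈ A.head? → ∃ k B, A = List.replicate (k + 1) a ++ B ∧
      a ∉ B.head? ∧ P B from (H A).1
  intro A
  induction A with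
  | nil => exact ⟨nil, by simp⟩
  | cons a l ih =>
    have key : ∃ k B, a :: l = List.replicate (k + 1) a ++ B ∧ a ∉ B.head? ∧ P B := by
      by_cases ha : a ∈ l.head?
      · obtain ⟨k, B, h1, h2, h3⟩ := ih.2 a ha
        exact ⟨k + 1, B, by rw [List.replicate_succ, List.cons_append, ← h1], h2, h3⟩
      · exact ⟨0, l, by simp, ha, ih.1⟩
    refine ⟨?_, fun b hb => ?_⟩
    · obtain ⟨k, B, h1, h2, h3⟩ := key
      rw [h1]
      exact run k a B h2 h3
    · have : a = b := by simpa using hb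
      exact this ▸ key

theorem base3_ne_nil (k : ℕ) : base3 (k + 1) ≠ [] := by
  simp [base3]

theorem base3_head (k : ℕ) : (0 : Fin 3) ∉ (base3 (k + 1)).head? := by
  have h0 : Nat.digits 3 (k + 1) ≠ [] := Nat.digits_ne_nil_iff_ne_zero.2 (by omega)
  have h1 := Nat.getLast_digit_ne_zero 3 (m := k + 1) (by omega)
  have h2 : (Nat.digits 3 (k + 1)).getLast h0 < 3 :=
    Nat.digits_lt_base (by norm_num) (List.getLast_mem h0)
  rw [base3, List.head?_map, List.head?_reverse, List.getLast?_eq_getLast_of_ne_nil h0]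
  generalize (Nat.digits 3 (k + 1)).getLast h0 = m at *
  interval_cases m
  · simp at h1
  · simp
  · simp

theorem say_ne_nil {A : Str} (h : A ≠ []) : say A ≠ [] := by
  induction A using run_induction with
  | nil => exact absurd rfl h
  | run k d B hB _ => rw [say_run k hB]; simp

theorem say_head (A : Str) : (0 : Fin 3) ∉ (say A).head? := by
  induction A using run_induction with
  | nil => simp
  | run k d B hB _ =>
    rw [say_run k hB, List.head?_append_of_ne_nil _ (base3_ne_nil k)]
    exact base3_head k

theorem say_getLast? (A : Str) : (say A).getLast? = A.getLast? := by
  induction A using run_induction with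
  | nil => rfl
  | run k d B hB ih =>
    rw [say_run k hB, List.getLast?_append, List.getLast?_cons, ih, List.getLast?_append]
    cases h : B.getLast? <;> simp [List.getLast?_replicate]

/-! ### Iterates and splitting -/

@[simp] theorem iter_zero (A : Str) : iter A 0 = A := rfl

theorem iter_succ' (A : Str) (n : ℕ) : iter A (n + 1) = say (iter A n) :=
  Function.iterate_succ_apply' say n A

theorem iter_add (A : Str) (m n : ℕ) : iter A (m + n) = iter (iter A m) n := by
  rw [iter, add_comm, Function.iterate_add_apply]; rfl

@[simp] theorem iter_nil (n : ℕ) : iter [] n = [] := by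
  induction n with
  | zero => rfl
  | succ n ih => rw [iter_succ', ih]; rfl

theorem iter_getLast? (A : Str) (n : ℕ) : (iter A n).getLast? = A.getLast? := by
  induction n with
  | zero => rfl
  | succ n ih => rw [iter_succ', say_getLast?, ih]

theorem iter_eq_self {A : Str} (h : say A = A) (n : ℕ) : iter A n = A :=
  Function.iterate_fixed h n

/-- Two neighbours do not interact during the first `n` steps if the last digit of the left one,
which no step changes, is not the first digit of the right one before the step `n`. -/
theorem iter_append_of_lt {L R : Str} {n : ℕ}
    (h : ∀ m < n, ∀ x ∈ L.getLast?, x ∉ (iter R m).head?) :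
    iter (L ++ R) n = iter L n ++ iter R n := by
  induction n with
  | zero => rfl
  | succ n ih =>
    rw [iter_succ', ih fun m hm => h m (by omega), say_append, ← iter_succ', ← iter_succ']
    rw [iter_getLast?]
    exact h n (Nat.lt_succ_self n)

theorem iter_append {L R : Str} (h : ∀ n, ∀ x ∈ L.getLast?, x ∉ (iter R n).head?) (n : ℕ) :
    iter (L ++ R) n = iter L n ++ iter R n :=
  iter_append_of_lt fun m _ => h m

/-- A string always splits after a `0` that ends a run. -/
theorem iter_append_of_zero {L R : Str} (hL : L.getLast? = some 0) (hR : (0 : Fin 3) ∉ R.head?)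
    (n : ℕ) : iter (L ++ R) n = iter L n ++ iter R n := by
  refine iter_append (fun n x hx => ?_) n
  obtain rfl : 0 = x := by simpa [hL] using hx
  cases n with
  | zero => exact hR
  | succ n => rw [iter_succ']; exact say_head _

theorem splitsAs_nil : SplitsAs [] [] := fun n => by simp

theorem splitsAs_singleton (A : Str) : SplitsAs A [A] := fun n => by simp

theorem SplitsAs.append {A B : Str} {P Q : List Str} (hA : SplitsAs A P) (hB : SplitsAs B Q)
    (h : ∀ n, iter (A ++ B) n = iter A n ++ iter B n) : SplitsAs (A ++ B) (P ++ Q) := fun n => by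
  rw [h, hA n, hB n]; simp

theorem SplitsAs.iter {A : Str} {P : List Str} (h : SplitsAs A P) (k : ℕ) :
    SplitsAs (iter A k) (P.map fun B => iter B k) := fun n => by
  rw [← iter_add, h]; simp [iter_add, Function.comp_def]

/-- A Boolean test for a list of strings whose concatenation splits into them, because each of
them ends in a `0` and the next one starts with another digit. -/
def zeroSplit : List Str → Bool
  | P :: Q :: t => P.getLast? == some 0 && (Q.head? == some 1 || Q.head? == some 2) &&
      zeroSplit (Q :: t)
  | _ => true

theorem splitsAs_of_zeroSplit {P : List Str} (h : zeroSplit P = true) :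
    SplitsAs P.flatten P := by
  induction P with
  | nil => exact splitsAs_nil
  | cons P t ih =>
    cases t with
    | nil => simpa using splitsAs_singleton P
    | cons Q t =>
      simp only [zeroSplit, Bool.and_eq_true, Bool.or_eq_true, beq_iff_eq] at h
      have h2 : (0 : Fin 3) ∉ (Q :: t).flatten.head? := by
        rw [List.flatten_cons, List.head?_append]
        rcases h.1.2 with h | h <;> simp [h]
      exact (splitsAs_singleton P).append (ih h.2) (iter_append_of_zero h.1.1 h2)

/-! ### Bounds on the lengths of runs -/

/-- Every maximal run of a digit `d` in `A` has length at most `b d`. -/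
def RunsLE (b : Fin 3 → ℕ) (A : Str) : Prop := ∀ r ∈ runs A, r.1 ≤ b r.2

theorem runsLE_run {b : Fin 3 → ℕ} {d : Fin 3} {B : Str} {k : ℕ} (h : d ∉ B.head?) :
    RunsLE b (List.replicate (k + 1) d ++ B) ↔ k + 1 ≤ b d ∧ RunsLE b B := by
  simp [RunsLE, runs_run k h]

theorem prefix_replicate_of_le {m n : ℕ} {d : Fin 3} (h : m ≤ n) :
    List.replicate m d <+: List.replicate n d :=
  ⟨List.replicate (n - m) d, by rw [List.replicate_append_replicate]; congr 1; omega⟩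

theorem suffix_replicate_of_le {m n : ℕ} {d : Fin 3} (h : m ≤ n) :
    List.replicate m d <:+ List.replicate n d :=
  ⟨List.replicate (n - m) d, by rw [List.replicate_append_replicate]; congr 1; omega⟩

/-- A block of equal digits inside a concatenation `X ++ Y` lies in one of the parts, or consists
of a block at the end of `X` and a block at the start of `Y`. -/
theorem replicate_infix_append {m : ℕ} {d : Fin 3} {X Y : Str}
    (h : List.replicate m d <:+: X ++ Y) :
    List.replicate m d <:+: X ∨ List.replicate m d <:+: Y ∨
      ∃ a c, m = (a + 1) + (c + 1) ∧ List.replicate (a + 1) d <:+ X ∧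
        List.replicate (c + 1) d <+: Y := by
  rcases List.infix_append_iff_ne_nil.1 h with h | h | ⟨l₁, l₂, n₁, n₂, e, h₁, h₂⟩
  · exact Or.inl h
  · exact Or.inr (Or.inl h)
  · refine Or.inr (Or.inr ?_)
    obtain ⟨e₀, e₁, e₂⟩ := List.append_eq_replicate_iff.1 e.symm
    have p₁ := List.length_pos_iff.2 n₁
    have p₂ := List.length_pos_iff.2 n₂
    refine ⟨l₁.length - 1, l₂.length - 1, by omega, ?_, ?_⟩
    · rwa [Nat.sub_add_cancel p₁, ← e₁]
    · rwa [Nat.sub_add_cancel p₂, ← e₂]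

theorem head?_of_replicate_prefix {c : ℕ} {d : Fin 3} {Y : Str}
    (h : List.replicate (c + 1) d <+: Y) : d ∈ Y.head? := by
  obtain ⟨t, rfl⟩ := h
  simp [List.replicate_succ]

theorem runsLE_iff {b : Fin 3 → ℕ} {A : Str} :
    RunsLE b A ↔ ∀ m d, List.replicate m d <:+: A → m ≤ b d := by
  induction A using run_induction with
  | nil =>
    simp only [RunsLE, runs, List.infix_nil, List.replicate_eq_nil_iff]
    simp +contextual
  | run k d B hB ih =>
    rw [runsLE_run hB, ih]
    constructor
    · rintro ⟨h1, h2⟩ m e hm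
      rcases replicate_infix_append hm with h | h | ⟨a, c, rfl, ha, hc⟩
      · rw [List.infix_replicate_iff] at h
        cases m with
        | zero => omega
        | succ m =>
          have : e = d := by simpa [List.replicate_inj] using h.2
          have := h.1
          simp only [List.length_replicate] at this
          subst e
          omega
      · exact h2 m e h
      · have he : e = d := by
          simpa [List.replicate_inj] using (List.suffix_replicate_iff.1 ha).2
        exact absurd (head?_of_replicate_prefix hc) (he ▸ hB)
    · intro h
      exact ⟨h _ _ (List.prefix_append _ _).isInfix,
        fun m e hm => h m e (hm.trans (List.suffix_append _ _).isInfix)⟩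

theorem RunsLE.infix {b : Fin 3 → ℕ} {A B : Str} (h : RunsLE b B) (hA : A <:+: B) :
    RunsLE b A :=
  runsLE_iff.2 fun m d hm => runsLE_iff.1 h m d (hm.trans hA)

theorem runsLE_length (A : Str) : RunsLE (fun _ => A.length) A :=
  runsLE_iff.2 fun m d hm => by simpa using hm.length_le

/-- A block of the digit `d` in `say A` meets the descriptions of at most two runs of `A`, and it
meets the second one only in the numeral: its length is at most `s d + p d`, where `s d` bounds
the blocks at the end of a description and `p d` the blocks at the start of a description of
a run of another digit. -/
theorem RunsLE.say {b s p : Fin 3 → ℕ} {A : Str} (hA : RunsLE b A)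
    (hi : ∀ k e d, k + 1 ≤ b e → ¬ List.replicate (s d + p d + 1) d <:+: base3 (k + 1) ++ [e])
    (hs : ∀ k e d, k + 1 ≤ b e → ¬ List.replicate (s d + 1) d <:+ base3 (k + 1) ++ [e])
    (hp : ∀ k e d, k + 1 ≤ b e → d ≠ e →
      ¬ List.replicate (p d + 1) d <+: base3 (k + 1) ++ [e]) :
    RunsLE (fun d => s d + p d) (say A) := by
  rw [runsLE_iff]
  induction A using run_induction with
  | nil => simp +contextual
  | run k e B hB ih =>
    rw [runsLE_run hB] at hA
    intro m d hm
    rw [say_run k hB, List.append_cons] at hm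
    by_contra! hlt
    rcases replicate_infix_append hm with h | h | ⟨a, c, rfl, ha, hc⟩
    · exact hi k e d hA.1 ((prefix_replicate_of_le hlt).isInfix.trans h)
    · exact hlt.not_ge (ih hA.2 m d h)
    · have ha' : a + 1 ≤ s d := by
        by_contra! hlt
        exact hs k e d hA.1 ((suffix_replicate_of_le hlt).trans ha)
      obtain rfl : d = e := by
        obtain ⟨t, ht⟩ := ha
        have := congrArg List.getLast? ht
        simpa [List.getLast?_append, List.getLast?_replicate] using this
      have hc' : c + 1 ≤ p d := by
        by_contra! hlt
        have hc := (prefix_replicate_of_le hlt).trans hc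
        induction B using run_induction with
        | nil => simpa using hc.length_le
        | run k' e' B' hB' _ =>
          have hde : d ≠ e' := by
            rintro rfl
            simp [List.replicate_succ] at hB
          rw [say_run k' hB', List.append_cons] at hc
          rw [runsLE_run hB'] at hA
          rcases List.prefix_or_prefix_of_prefix hc (List.prefix_append _ _) with h | h
          · exact hp k' e' d hA.2.1 hde h
          · have : e' ∈ List.replicate (p d + 1) d := h.subset (by simp)
            exact hde (List.eq_of_mem_replicate this).symm
      omega

theorem numeral_length_le {k M : ℕ} (h : k ≤ M) :
    (base3 k).length ≤ (Nat.digits 3 M).length := by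
  rw [base3, List.length_map, List.length_reverse]
  exact Nat.le_length_digits_le 3 k M h

/-- If all runs have length at most `M`, and `M` has `D` digits in base 3, then after one step
all runs have length at most `2 * D + 1`. -/
theorem RunsLE.say_const {M : ℕ} {A : Str} (hA : RunsLE (fun _ => M) A) :
    RunsLE (fun _ => 2 * (Nat.digits 3 M).length + 1) (LookAndSay.say A) := by
  set D := (Nat.digits 3 M).length with hD
  have hlen : ∀ k (e : Fin 3), k + 1 ≤ M → (base3 (k + 1) ++ [e]).length ≤ D + 1 := by
    intro k e h
    simpa using numeral_length_le h
  have := hA.say (s := fun _ => D + 1) (p := fun _ => D) ?_ ?_ ?_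
  · convert this using 2
    ring
  · intro k e d hk h
    have h1 := h.length_le.trans (hlen k e hk)
    simp only [List.length_replicate] at h1
    omega
  · intro k e d hk h
    have h1 := h.length_le.trans (hlen k e hk)
    simp only [List.length_replicate] at h1
    omega
  · intro k e d hk hde h
    have h1 := hlen k e hk
    have h2 := h.eq_of_length_le (by simpa using h1)
    have : e ∈ List.replicate (D + 1) d := h2 ▸ (by simp)
    exact hde (List.eq_of_mem_replicate this).symm

theorem two_mul_digits_length_lt {M : ℕ} (h : 9 ≤ M) : 2 * (Nat.digits 3 M).length + 1 < M := by
  have h1 : 3 ^ (Nat.digits 3 M).length ≤ 3 * M :=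
    Nat.base_pow_length_digits_le 3 M (by norm_num) (by omega)
  have h2 : 3 ≤ (Nat.digits 3 M).length := Nat.le_length_digits_le 3 9 M h
  generalize (Nat.digits 3 M).length = D at *
  obtain ⟨E, rfl⟩ := Nat.exists_eq_add_of_le h2
  have h3 : 3 * (2 * (3 + E) + 1) < 3 ^ (3 + E) := by
    clear h1 h2
    induction E with
    | zero => norm_num
    | succ E ih => rw [← add_assoc, pow_succ]; omega
  omega

/-- The bounds `1`, `4`, `3` for the runs of the digits `0`, `1`, `2`. -/
abbrev hBound : Fin 3 → ℕ := ![1, 4, 3]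

/-- The bounds `1`, `3`, `3` for the runs of the digits `0`, `1`, `2`. -/
abbrev gBound : Fin 3 → ℕ := ![1, 3, 3]

/-- The first five base-3 numerals, in a form suited to computation. -/
def numeral : ℕ → Str
  | 1 => [1]
  | 2 => [2]
  | 3 => [1, 0]
  | 4 => [1, 1]
  | 5 => [1, 2]
  | n => base3 n

theorem base3_eq_numeral : base3 = numeral := by
  funext n
  match n with
  | 0 => rfl
  | 1 => simp [base3, numeral]; rfl
  | 2 => simp [base3, numeral]
  | 3 => simp [base3, numeral]; rfl
  | 4 => simp [base3, numeral]; rfl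
  | 5 => simp [base3, numeral]; rfl
  | n + 6 => rfl

/-- Form of `RunsLE.say` for runs of length at most five, with decidable hypotheses. -/
theorem RunsLE.say_of_decide {b : Fin 3 → ℕ} (s p : Fin 3 → ℕ) {A : Str} (hA : RunsLE b A)
    (hb : ∀ e, b e ≤ 5)
    (h : ∀ e d, ∀ k < 5, k + 1 ≤ b e →
      ¬ List.replicate (s d + p d + 1) d <:+: numeral (k + 1) ++ [e] ∧
      ¬ List.replicate (s d + 1) d <:+ numeral (k + 1) ++ [e] ∧
      (d ≠ e → ¬ List.replicate (p d + 1) d <+: numeral (k + 1) ++ [e])) :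
    RunsLE (fun d => s d + p d) (LookAndSay.say A) := by
  have h' : ∀ k e d, k + 1 ≤ b e → _ := fun k e d hk => h e d k (by have := hb e; omega) hk
  rw [← base3_eq_numeral] at h'
  exact hA.say (fun k e d hk => (h' k e d hk).1) (fun k e d hk => (h' k e d hk).2.1)
    (fun k e d hk => (h' k e d hk).2.2)

theorem RunsLE.mono {b b' : Fin 3 → ℕ} {A : Str} (h : RunsLE b A) (hb : ∀ d, b d ≤ b' d) :
    RunsLE b' A := fun r hr => (h r hr).trans (hb _)

theorem RunsLE.say_hBound {A : Str} (h : RunsLE hBound A) : RunsLE hBound (LookAndSay.say A) :=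
  (h.say_of_decide ![1, 3, 2] ![0, 1, 1] (by decide) (by decide)).mono (by decide)

theorem RunsLE.say_gBound {A : Str} (h : RunsLE gBound A) : RunsLE gBound (LookAndSay.say A) :=
  (h.say_of_decide ![1, 2, 2] ![0, 1, 1] (by decide) (by decide)).mono (by decide)

theorem RunsLE.iter_gBound {A : Str} (h : RunsLE gBound A) (n : ℕ) :
    RunsLE gBound (iter A n) := by
  induction n with
  | zero => exact h
  | succ n ih => rw [iter_succ']; exact ih.say_gBound

theorem RunsLE.iter_hBound {A : Str} (h : RunsLE hBound A) (n : ℕ) :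
    RunsLE hBound (iter A n) := by
  induction n with
  | zero => exact h
  | succ n ih => rw [iter_succ']; exact ih.say_hBound

/-- After finitely many steps the runs of `0`, `1`, `2` have length at most `1`, `4`, `3`. -/
theorem exists_iter_hBound (A : Str) : ∃ n, RunsLE hBound (iter A n) := by
  have five : ∀ A : Str, RunsLE (fun _ => 5) A → ∃ n, RunsLE hBound (iter A n) := fun A h =>
    have h1 : RunsLE ![2, 5, 3] (LookAndSay.say A) :=
      (h.say_of_decide ![2, 3, 2] ![0, 2, 1] (by decide) (by decide)).mono (by decide)
    ⟨2, (h1.say_of_decide ![1, 3, 2] ![0, 1, 1] (by decide) (by decide)).mono (by decide)⟩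
  suffices H : ∀ M, ∀ A : Str, RunsLE (fun _ => M) A → ∃ n, RunsLE hBound (iter A n) from
    H _ A (runsLE_length A)
  intro M
  induction M using Nat.strong_induction_on with
  | _ M ih =>
    intro A hA
    rcases lt_or_ge M 9 with hM | hM
    · have h1 : RunsLE (fun _ => 5) (LookAndSay.say A) :=
        (hA.mono (fun _ => Nat.le_of_lt_succ hM) : RunsLE (fun _ => 8) A).say_const.mono
          (by simp)
      obtain ⟨n, hn⟩ := five _ h1
      exact ⟨n + 1, hn⟩
    · obtain ⟨n, hn⟩ := ih _ (two_mul_digits_length_lt hM) _ hA.say_const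
      exact ⟨n + 1, hn⟩

/-! ### The real root of `x ^ 3 - x - 1` -/

theorem exists_plastic : ∃ x : ℝ, (1.3247 ≤ x ∧ x < 1.3248) ∧ x ^ 3 = x + 1 := by
  have hc : ContinuousOn (fun x : ℝ => x ^ 3 - x - 1) (Set.Icc 1.3247 1.3248) := by fun_prop
  obtain ⟨x, ⟨h1, h2⟩, h3⟩ := intermediate_value_Ico (by norm_num) hc
    (show (0 : ℝ) ∈ _ by constructor <;> norm_num)
  exact ⟨x, ⟨h1, h2⟩, by simp only at h3; linarith⟩

/-- The real root `1.3247…` of `x ^ 3 - x - 1`, known as the plastic ratio. -/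
noncomputable def plastic : ℝ := exists_plastic.choose

local notation "ρ" => plastic

theorem plastic_ge : 1.3247 ≤ ρ := exists_plastic.choose_spec.1.1
theorem plastic_lt : ρ < 1.3248 := exists_plastic.choose_spec.1.2
theorem plastic_cube : ρ ^ 3 = ρ + 1 := exists_plastic.choose_spec.2

theorem plastic_pos : 0 < ρ := by linarith [plastic_ge]

theorem one_lt_plastic : 1 < ρ := by linarith [plastic_ge]

theorem cubic_eq_zero_iff (x : ℝ) : x ^ 3 - x - 1 = 0 ↔ x = ρ := by
  constructor
  · intro h
    have h1 : (x - ρ) * (x ^ 2 + ρ * x + (ρ ^ 2 - 1)) = 0 := by linear_combination h - plastic_cube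
    rcases mul_eq_zero.1 h1 with h2 | h2
    · linarith
    · nlinarith [plastic_ge, sq_nonneg (2 * x + ρ)]
  · rintro rfl
    linarith [plastic_cube]

/-! ### Sequences of growth rate `ρ` -/

/-- `u n ~ c * ρ ^ n`, with `c = 0` meaning `u n = o(ρ ^ n)`. -/
def HasRate (u : ℕ → ℝ) (c : ℝ) : Prop := Tendsto (fun n => u n / ρ ^ n) atTop (𝓝 c)

theorem HasRate.add {u v : ℕ → ℝ} {c d : ℝ} (hu : HasRate u c) (hv : HasRate v d) :
    HasRate (fun n => u n + v n) (c + d) :=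
  (Tendsto.add hu hv).congr fun n => by ring

theorem HasRate.sub {u v : ℕ → ℝ} {c d : ℝ} (hu : HasRate u c) (hv : HasRate v d) :
    HasRate (fun n => u n - v n) (c - d) :=
  (Tendsto.sub hu hv).congr fun n => by ring

theorem hasRate_shift {u : ℕ → ℝ} {c : ℝ} (k : ℕ) :
    HasRate (fun n => u (n + k)) (ρ ^ k * c) ↔ HasRate u c := by
  have hk : (ρ ^ k) ≠ 0 := (pow_pos plastic_pos k).ne'
  rw [HasRate, HasRate, ← tendsto_add_atTop_iff_nat (f := fun n => u n / ρ ^ n) k]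
  have e : ∀ n, u (n + k) / ρ ^ n = ρ ^ k * (u (n + k) / ρ ^ (n + k)) := fun n => by
    rw [pow_add]
    field_simp
  simp_rw [e]
  constructor
  · intro h
    have := h.const_mul (ρ ^ k)⁻¹
    simpa [← mul_assoc, inv_mul_cancel₀ hk] using this
  · exact fun h => h.const_mul _

/-- A recurrence whose coefficients have absolute values adding up to less than `1` is
a contraction: its solutions tend to the fixed point. -/
theorem tendsto_of_contraction {K i : ℕ} (hi : i < K) {a b L : ℝ} (hab : |a| + |b| < 1)
    {e f : ℕ → ℝ} (he : ∀ n, e (n + K) = a * e (n + i) + b * e n + f n)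
    (hf : Tendsto f atTop (𝓝 L)) : Tendsto e atTop (𝓝 (L / (1 - a - b))) := by
  have hd : 0 < 1 - a - b := by linarith [le_abs_self a, le_abs_self b]
  set x := L / (1 - a - b) with hx
  have hL : L = x * (1 - a - b) := by rw [hx]; field_simp
  have hr : ∀ n, e (n + K) - x = a * (e (n + i) - x) + b * (e n - x) + (f n - L) := fun n => by
    rw [he, hL]; ring
  have hle : ∀ n, |e (n + K) - x| ≤ |a| * |e (n + i) - x| + |b| * |e n - x| + |f n - L| :=
    fun n => by
    rw [hr, ← abs_mul, ← abs_mul]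
    exact (abs_add_le _ _).trans (by gcongr; exact abs_add_le _ _)
  have hf0 : Tendsto (fun n => |f n - L|) atTop (𝓝 0) := by
    simpa using (hf.sub_const L).abs
  set q := |a| + |b| with hq
  have hq0 : 0 ≤ q := by positivity
  obtain ⟨F, hF⟩ := hf0.bddAbove_range
  have hF : ∀ n, |f n - L| ≤ F := fun n => hF ⟨n, rfl⟩
  -- a bound for the whole sequence
  obtain ⟨C, hC0, hC⟩ : ∃ C, 0 < C ∧ ∀ n, |e n - x| ≤ C := by
    refine ⟨∑ j ∈ Finset.range K, |e j - x| + F / (1 - q) + 1, ?_, ?_⟩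
    · have : 0 ≤ F := (abs_nonneg _).trans (hF 0)
      have : 0 ≤ F / (1 - q) := div_nonneg this (by linarith)
      positivity
    · set C := ∑ j ∈ Finset.range K, |e j - x| + F / (1 - q) + 1 with hCdef
      have hsum : 0 ≤ ∑ j ∈ Finset.range K, |e j - x| := Finset.sum_nonneg fun _ _ => abs_nonneg _
      have hF1 : 0 ≤ F / (1 - q) := div_nonneg ((abs_nonneg _).trans (hF 0)) (by linarith)
      have hFC : F ≤ (1 - q) * C := by
        have : F = (1 - q) * (F / (1 - q)) := by
          have : 1 - q ≠ 0 := by linarith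
          field_simp
        rw [this]
        have : 0 ≤ 1 - q := by linarith
        gcongr
        linarith
      intro n
      induction n using Nat.strong_induction_on with
      | _ n ih =>
        rcases lt_or_ge n K with hn | hn
        · have := Finset.single_le_sum (f := fun j => |e j - x|) (fun _ _ => abs_nonneg _)
            (Finset.mem_range.2 hn)
          linarith
        · obtain ⟨m, rfl⟩ := Nat.exists_eq_add_of_le' hn
          have h1 := ih (m + i) (by omega)
          have h2 := ih m (by omega)
          calc _ ≤ _ := hle m
            _ ≤ |a| * C + |b| * C + F := by gcongr; exact hF m
            _ = q * C + F := by rw [hq]; ring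
            _ ≤ C := by linarith
  -- with `r` between `q` and `1`, the bound eventually improves by the factor `r`
  set r := (q + 1) / 2 with hrdef
  have key : ∀ k : ℕ, ∀ᶠ n in atTop, |e n - x| ≤ r ^ k * C := by
    intro k
    induction k with
    | zero => exact Eventually.of_forall fun n => by simpa using hC n
    | succ k ih =>
      have hpos : 0 < (r - q) * (r ^ k * C) := by
        have : 0 < r := by positivity
        have : 0 < r - q := by rw [hrdef]; linarith
        positivity
      rw [← eventually_map (m := fun n : ℕ => n) (P := fun n => |e n - x| ≤ r ^ (k + 1) * C),
        Filter.map_id', ← Filter.map_add_atTop_eq_nat K, eventually_map]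
      filter_upwards [ih, (tendsto_add_atTop_nat i).eventually ih, hf0.eventually_le_const hpos]
        with n h1 h2 h3
      calc _ ≤ _ := hle n
        _ ≤ |a| * (r ^ k * C) + |b| * (r ^ k * C) + (r - q) * (r ^ k * C) := by gcongr
        _ = r ^ (k + 1) * C := by rw [hq]; ring
  rw [tendsto_iff_norm_sub_tendsto_zero]
  refine tendsto_order.2 ⟨fun y hy => Eventually.of_forall fun n => hy.trans_le (norm_nonneg _),
    fun y hy => ?_⟩
  have hlim : Tendsto (fun k : ℕ => r ^ k * C) atTop (𝓝 0) := by
    simpa using (tendsto_pow_atTop_nhds_zero_of_lt_one (by positivity)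
      (by rw [hrdef]; linarith)).mul_const C
  obtain ⟨k, hk⟩ := (hlim.eventually_lt_const hy).exists
  filter_upwards [key k] with n hn
  exact hn.trans_lt hk

/-- The form of `tendsto_of_contraction` for a recurrence of sequences of rate `ρ`. -/
theorem hasRate_of_contraction {K i : ℕ} (hi : i < K) {a b L : ℝ}
    (hab : |a| * ρ ^ i + |b| < ρ ^ K) {u v : ℕ → ℝ}
    (hu : ∀ n, u (n + K) = a * u (n + i) + b * u n + v n) (hv : HasRate v L) :
    HasRate u (L / (ρ ^ K - a * ρ ^ i - b)) := by
  have hK : 0 < ρ ^ K := pow_pos plastic_pos K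
  have hi0 : 0 < ρ ^ i := pow_pos plastic_pos i
  have h := tendsto_of_contraction hi (a := a * ρ ^ i / ρ ^ K) (b := b / ρ ^ K)
    (e := fun n => u n / ρ ^ n) (f := fun n => v n / ρ ^ n / ρ ^ K) (L := L / ρ ^ K) ?_ ?_
    (hv.div_const _)
  · rw [HasRate]
    convert h using 2
    field_simp
  · rw [abs_div, abs_div, abs_mul, abs_of_pos hK, abs_of_pos hi0, ← add_div, div_lt_one hK]
    exact hab
  · intro n
    have hn : 0 < ρ ^ n := pow_pos plastic_pos n
    simp only [hu, pow_add]
    field_simp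

/-- If `u (n + p) = u n + v n` and `v` grows at the rate `ρ`, then so does `u`. -/
theorem hasRate_of_period {p : ℕ} (hp : p ≠ 0) {L : ℝ} {u v : ℕ → ℝ}
    (hu : ∀ n, u (n + p) = u n + v n) (hv : HasRate v L) : HasRate u (L / (ρ ^ p - 1)) := by
  have := hasRate_of_contraction (Nat.pos_of_ne_zero hp) (a := 0) (b := 1) (u := u) (v := v)
    (by simpa using one_lt_pow₀ one_lt_plastic hp) (fun n => by rw [hu]; ring) hv
  simpa using this

/-- A nonnegative solution of `v (n + 3) = v (n + 1) + v n`, the recurrence with characteristic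
polynomial `x ^ 3 - x - 1`, grows exactly at the rate `ρ` unless it starts with zeros. -/
theorem exists_hasRate_of_padovan {v : ℕ → ℝ} (h0 : 0 < v 0) (h1 : 0 < v 1) (h2 : 0 < v 2)
    (h : ∀ n, v (n + 3) = v (n + 1) + v n) : ∃ c, 0 < c ∧ HasRate v c := by
  have hρ := plastic_cube
  have hρ0 := plastic_pos
  have hge := plastic_ge
  have hlt := plastic_lt
  -- the cofactor `x ^ 2 + ρ x + (ρ ^ 2 - 1)` of `x - ρ` turns `v` into a geometric sequence
  have hu : ∀ n, v (n + 2) + ρ * v (n + 1) + (ρ ^ 2 - 1) * v n =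
      (v 2 + ρ * v 1 + (ρ ^ 2 - 1) * v 0) * ρ ^ n := by
    intro n
    induction n with
    | zero => simp
    | succ n ih =>
      have e := h n
      simp only [add_assoc, Nat.reduceAdd]
      linear_combination ρ * ih + e - v n * hρ
  set u₀ := v 2 + ρ * v 1 + (ρ ^ 2 - 1) * v 0 with hu₀
  have hu₀pos : 0 < u₀ := by
    have : 0 < ρ ^ 2 - 1 := by nlinarith
    positivity
  -- multiplying the cofactor by `x ^ 2 - ρ x + (ρ ^ 2 - 1)` gives a contraction
  have hv : ∀ n, v (n + 4) = (2 - ρ ^ 2) * v (n + 2) + (-(ρ ^ 2 - 1) ^ 2) * v n +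
      (ρ ^ 2 - 1) * u₀ * ρ ^ n := by
    intro n
    have e0 := hu n
    have e1 := hu (n + 1)
    have e2 := hu (n + 2)
    rw [pow_succ] at e1
    rw [pow_add] at e2
    simp only [add_assoc, Nat.reduceAdd] at e0 e1 e2
    linear_combination e2 - ρ * e1 + (ρ ^ 2 - 1) * e0
  have hconst : HasRate (fun n => (ρ ^ 2 - 1) * u₀ * ρ ^ n) ((ρ ^ 2 - 1) * u₀) := by
    refine tendsto_const_nhds.congr fun n => ?_
    have : 0 < ρ ^ n := pow_pos hρ0 n
    field_simp
  have hsq1 : 1.7548 < ρ ^ 2 := by nlinarith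
  have hsq2 : ρ ^ 2 < 1.7552 := by nlinarith
  have h4 : ρ ^ 4 = ρ ^ 2 + ρ := by linear_combination ρ * hρ
  have hb : (ρ ^ 2 - 1) ^ 2 < 0.6 := by nlinarith
  have hrate := hasRate_of_contraction (K := 4) (i := 2) (by norm_num) ?_ hv hconst
  · refine ⟨_, div_pos (mul_pos (by linarith) hu₀pos) ?_, hrate⟩
    nlinarith
  · rw [abs_of_pos (by linarith), abs_neg, abs_of_nonneg (sq_nonneg _), h4]
    nlinarith

/-! ### Computing iterates -/

/-- The look-and-say step, in a form suited to computation. -/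
def sayC (A : Str) : Str := (runs A).flatMap fun r => numeral r.1 ++ [r.2]

theorem say_eq_sayC : say = sayC := by
  funext A
  rw [say, base3_eq_numeral, sayC]

theorem splitsAs_iter_of_check {A : Str} {p : ℕ} {P : List Str}
    (h : (sayC^[p] A == P.flatten && zeroSplit P) = true) : SplitsAs (iter A p) P := by
  simp only [Bool.and_eq_true, beq_iff_eq] at h
  rw [iter, say_eq_sayC, h.1]
  exact splitsAs_of_zeroSplit h.2

/-! ### Growing strings -/

/-- The lengths of the iterates of `A` grow like a positive multiple of `ρ ^ n`. -/
def Grows (A : Str) : Prop := ∃ c, 0 < c ∧ HasRate (fun n => ((iter A n).length : ℝ)) c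

theorem grows_iter_iff {A : Str} (k : ℕ) : Grows (iter A k) ↔ Grows A := by
  have hk : 0 < ρ ^ k := pow_pos plastic_pos k
  have e : (fun n => ((iter (iter A k) n).length : ℝ)) =
      fun n => ((iter A (n + k)).length : ℝ) := by
    funext n
    rw [← iter_add, add_comm]
  simp only [Grows, e]
  constructor
  · rintro ⟨c, hc, h⟩
    refine ⟨c / ρ ^ k, div_pos hc hk, (hasRate_shift k).1 ?_⟩
    rwa [mul_div_cancel₀ _ hk.ne']
  · rintro ⟨c, hc, h⟩
    exact ⟨ρ ^ k * c, mul_pos hk hc, (hasRate_shift k).2 h⟩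

/-- The strings into which everything decays: the neutrinos and the growing strings. -/
def Elementary (A : Str) : Prop := A ∈ neutrinos ∨ Grows A

theorem say_neutrino {A : Str} (h : A ∈ neutrinos) : say A = A := by
  rw [say_eq_sayC]
  revert A
  decide

theorem Elementary.iter {A : Str} (h : Elementary A) (k : ℕ) : Elementary (iter A k) := by
  rcases h with h | h
  · left
    rwa [iter_eq_self (say_neutrino h)]
  · exact Or.inr ((grows_iter_iff k).2 h)

theorem Elementary.exists_rate {A : Str} (h : Elementary A) :
    ∃ c, 0 ≤ c ∧ HasRate (fun n => ((LookAndSay.iter A n).length : ℝ)) c := by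
  rcases h with h | ⟨c, hc, h⟩
  · refine ⟨0, le_rfl, ?_⟩
    simp only [iter_eq_self (say_neutrino h), HasRate]
    exact tendsto_const_nhds.div_atTop (tendsto_pow_atTop_atTop_of_one_lt one_lt_plastic)
  · exact ⟨c, hc.le, h⟩

theorem exists_rate_of_elementary {P : List Str} (h : ∀ B ∈ P, Elementary B) :
    ∃ c, 0 ≤ c ∧ ((∃ B ∈ P, Grows B) → 0 < c) ∧
      HasRate (fun n => (P.map fun B => ((iter B n).length : ℝ)).sum) c := by
  induction P with
  | nil => exact ⟨0, le_rfl, by simp, by simp [HasRate]⟩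
  | cons B P ih =>
    obtain ⟨c, hc, hpos, hr⟩ := ih fun B hB => h B (by simp [hB])
    by_cases hB : Grows B
    · obtain ⟨b, hb, hbr⟩ := hB
      exact ⟨b + c, by positivity, fun _ => by positivity, by simpa using hbr.add hr⟩
    · obtain ⟨b, hb, hbr⟩ := (h B (by simp)).exists_rate
      refine ⟨b + c, by positivity, fun hex => ?_, by simpa using hbr.add hr⟩
      have : 0 < c := hpos (by simpa [hB] using hex)
      positivity

theorem length_of_splitsAs {A : Str} {P : List Str} (h : SplitsAs A P) (n : ℕ) :
    ((iter A n).length : ℝ) = (P.map fun B => ((iter B n).length : ℝ)).sum := by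
  rw [h n, List.length_flatten, List.map_map, Nat.cast_list_sum, List.map_map]
  rfl

theorem grows_of_splitsAs {A : Str} {P : List Str} (h : SplitsAs A P)
    (hP : ∀ B ∈ P, Elementary B) (hex : ∃ B ∈ P, Grows B) : Grows A := by
  obtain ⟨c, -, hc, hr⟩ := exists_rate_of_elementary hP
  refine ⟨c, hc hex, ?_⟩
  simpa only [length_of_splitsAs h] using hr

theorem grows_of_decay {A : Str} (p : ℕ) (P : List Str) (hne : P ≠ [])
    (h : (sayC^[p] A == P.flatten && zeroSplit P) = true) (hP : ∀ B ∈ P, Grows B) : Grows A := by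
  obtain ⟨B, hB⟩ := List.exists_mem_of_ne_nil P hne
  exact (grows_iter_iff p).1 (grows_of_splitsAs (splitsAs_iter_of_check h)
    (fun B hB => Or.inr (hP B hB)) ⟨B, hB, hP B hB⟩)

/-- A string that reproduces itself periodically and emits growing strings in each period
grows. -/
theorem grows_of_period {A : Str} (p : ℕ) (P Q : List Str) (hp : p ≠ 0) (hne : P ++ Q ≠ [])
    (h : (sayC^[p] A == (P ++ A :: Q).flatten && zeroSplit (P ++ A :: Q)) = true)
    (hPQ : ∀ B ∈ P ++ Q, Grows B) : Grows A := by
  obtain ⟨B, hB⟩ := List.exists_mem_of_ne_nil _ hne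
  obtain ⟨c, -, hc, hr⟩ := exists_rate_of_elementary fun B hB => Or.inr (hPQ B hB)
  refine ⟨_, div_pos (hc ⟨B, hB, hPQ B hB⟩) ?_, hasRate_of_period hp (fun n => ?_) hr⟩
  · linarith [one_lt_pow₀ one_lt_plastic hp]
  · rw [add_comm, iter_add, length_of_splitsAs (splitsAs_iter_of_check h)]
    simp only [List.map_append, List.map_cons, List.sum_append, List.sum_cons]
    ring

/-! ### The fermions grow -/

/-- Eliminating the other fermions from the system of recurrences leaves, for the lengths of the
iterates of `E`, the characteristic polynomial `(x ^ 3 - x - 1) * (x ^ 5 - x ^ 3 + 1)`. Its first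
factor governs the sequence `v`, and the second one is a contraction at the rate `ρ`. -/
theorem grows_E : Grows [1, 0] := by
  set E : ℕ → ℝ := fun n => ((iter [1, 0] n).length : ℝ) with hE
  set U : ℕ → ℝ := fun n => ((iter [1, 1, 0] n).length : ℝ) with hU
  set D : ℕ → ℝ := fun n => ((iter [2, 1, 1, 0] n).length : ℝ) with hD
  set B : ℕ → ℝ := fun n => ((iter [2, 2, 1, 1, 0] n).length : ℝ) with hB
  have recE : ∀ n, E (n + 2) = E n + U n := fun n => by
    have h : SplitsAs (iter [1, 0] 2) [[1, 0], [1, 1, 0]] := splitsAs_iter_of_check (by decide)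
    simp only [hE, hU]
    rw [add_comm, iter_add, length_of_splitsAs h]
    simp
  have recU : ∀ n, U (n + 1) = D n := fun n => by
    have h : SplitsAs (iter [1, 1, 0] 1) [[2, 1, 1, 0]] := splitsAs_iter_of_check (by decide)
    simp only [hU, hD]
    rw [add_comm, iter_add, length_of_splitsAs h]
    simp
  have recD : ∀ n, D (n + 3) = D n + B n := fun n => by
    have h : SplitsAs (iter [2, 1, 1, 0] 3) [[2, 1, 1, 0], [2, 2, 1, 1, 0]] :=
      splitsAs_iter_of_check (by decide)
    simp only [hD, hB]
    rw [add_comm, iter_add, length_of_splitsAs h]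
    simp
  have recB : ∀ n, B (n + 2) = E n + B n := fun n => by
    have h : SplitsAs (iter [2, 2, 1, 1, 0] 2) [[1, 0], [2, 2, 1, 1, 0]] :=
      splitsAs_iter_of_check (by decide)
    simp only [hE, hB]
    rw [add_comm, iter_add, length_of_splitsAs h]
    simp
  have hEpos : ∀ n, 0 < E n := by
    intro n
    simp only [hE, Nat.cast_pos, List.length_pos_iff]
    induction n with
    | zero => simp
    | succ n ih => rw [iter_succ']; exact say_ne_nil ih
  set v : ℕ → ℝ := fun n => U (n + 3) + E n with hv
  have hvpos : ∀ n, 0 < v n := fun n => by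
    have : 0 ≤ U (n + 3) := Nat.cast_nonneg _
    have := hEpos n
    positivity
  have recv : ∀ n, v (n + 3) = v (n + 1) + v n := fun n => by
    have e1 := recU (n + 5)
    have e2 := recD (n + 2)
    have e3 := recB n
    have e4 := recU (n + 3)
    have e5 := recD n
    have e6 := recU (n + 2)
    have e7 := recE (n + 1)
    have e8 := recU n
    simp only [hv, add_assoc, Nat.reduceAdd] at *
    linarith
  obtain ⟨c, hc, hr⟩ := exists_hasRate_of_padovan (hvpos 0) (hvpos 1) (hvpos 2) recv
  have h3 := plastic_cube
  have h5 : ρ ^ 5 = ρ ^ 3 + ρ ^ 2 := by linear_combination ρ ^ 2 * h3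
  have h2 : 1 < ρ ^ 2 := one_lt_pow₀ one_lt_plastic (by norm_num)
  have := hasRate_of_contraction (K := 5) (i := 3) (a := 1) (b := -1) (u := E) (by norm_num)
    (by simp only [abs_neg, abs_one, one_mul]; linarith) (fun n => ?_) hr
  · exact ⟨_, div_pos hc (by linarith), this⟩
  · have e := recE (n + 3)
    simp only [hv, add_assoc, Nat.reduceAdd] at *
    linarith

/-- If `iter A p` splits as `A.B`, then the lengths for `B` are differences of those for `A`. -/
theorem grows_of_emit {A B : Str} (p : ℕ) (hp : p ≠ 0)
    (h : (sayC^[p] A == [A, B].flatten && zeroSplit [A, B]) = true) (hA : Grows A) : Grows B := by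
  obtain ⟨c, hc, hr⟩ := hA
  have h1 := ((hasRate_shift p).2 hr).sub hr
  refine ⟨ρ ^ p * c - c, ?_, ?_⟩
  · have := one_lt_pow₀ one_lt_plastic hp
    nlinarith
  · refine h1.congr fun n => ?_
    congr 1
    beta_reduce
    rw [add_comm n p, iter_add, length_of_splitsAs (splitsAs_iter_of_check h)]
    simp

theorem grows_of_iter_eq {A B : Str} (p : ℕ) (h : sayC^[p] A = B) (hA : Grows A) : Grows B := by
  rw [← h, ← say_eq_sayC]
  exact (grows_iter_iff p).2 hA

theorem grows_M : Grows [1, 1, 1, 0] := grows_of_iter_eq 1 (by decide) grows_E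
theorem grows_U : Grows [1, 1, 0] := grows_of_emit 2 (by norm_num) (by decide) grows_E
theorem grows_D : Grows [2, 1, 1, 0] := grows_of_iter_eq 1 (by decide) grows_U
theorem grows_S : Grows [1, 2, 2, 1, 1, 0] := grows_of_iter_eq 1 (by decide) grows_D
theorem grows_C : Grows [1, 1, 2, 2, 2, 1, 1, 0] := grows_of_iter_eq 2 (by decide) grows_D
theorem grows_B : Grows [2, 2, 1, 1, 0] := grows_of_emit 3 (by norm_num) (by decide) grows_D
theorem grows_T : Grows [2, 2, 2, 1, 1, 0] := grows_of_iter_eq 1 (by decide) grows_B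

/-! ### Further growing strings -/

theorem grows_2210 : Grows [2, 2, 1, 0] :=
  grows_of_period 2 [] [[1, 1, 0]] (by norm_num) (by simp) (by decide) (by simp [grows_U])

theorem grows_22112 : Grows [2, 2, 1, 1, 2] :=
  grows_of_period 2 [[1, 0]] [] (by norm_num) (by simp) (by decide) (by simp [grows_E])

theorem grows_2211210 : Grows [2, 2, 1, 1, 2, 1, 0] :=
  grows_of_period 2 [[1, 0]] [[1, 1, 0]] (by norm_num) (by simp) (by decide)
    (by simp [grows_E, grows_U])

theorem grows_221121110 : Grows [2, 2, 1, 1, 2, 1, 1, 1, 0] :=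
  grows_of_period 2 [[1, 0]] [[2, 1, 1, 0]] (by norm_num) (by simp) (by decide)
    (by simp [grows_E, grows_D])

theorem grows_211210 : Grows [2, 1, 1, 2, 1, 0] :=
  grows_of_decay 3 [[2, 1, 1, 0], [2, 2, 1, 1, 2, 1, 1, 1, 0], [2, 1, 1, 0]] (by simp)
    (by decide) (by simp [grows_D, grows_221121110])

theorem grows_111210 : Grows [1, 1, 1, 2, 1, 0] :=
  grows_of_decay 2 [[1, 1, 1, 0], [2, 1, 1, 2, 1, 0], [1, 1, 0]] (by simp)
    (by decide) (by simp [grows_M, grows_211210, grows_U])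

theorem grows_121110 : Grows [1, 2, 1, 1, 1, 0] :=
  grows_of_decay 1 [[1, 1, 1, 2, 1, 0], [1, 1, 0]] (by simp)
    (by decide) (by simp [grows_111210, grows_U])

theorem grows_211 : Grows [2, 1, 1] :=
  grows_of_period 4 [[1, 2, 1, 1, 1, 0]] [] (by norm_num) (by simp) (by decide)
    (by simp [grows_121110])

theorem grows_21122 : Grows [2, 1, 1, 2, 2] :=
  grows_of_period 4 [[1, 2, 1, 1, 1, 0]] [] (by norm_num) (by simp) (by decide)
    (by simp [grows_121110])

theorem grows_2112210 : Grows [2, 1, 1, 2, 2, 1, 0] :=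
  grows_of_period 4 [[1, 2, 1, 1, 1, 0]] [[1, 1, 0], [1, 2, 2, 1, 1, 0]] (by norm_num) (by simp)
    (by decide) (by simp [grows_121110, grows_U, grows_S])

theorem grows_12212210 : Grows [1, 2, 2, 1, 2, 2, 1, 0] :=
  grows_of_period 4 [[1, 1, 1, 2, 1, 0], [1, 1, 0]] [[1, 1, 0], [1, 2, 2, 1, 1, 0]] (by norm_num)
    (by simp) (by decide) (by simp [grows_111210, grows_U, grows_S])

/-! ### Strings that decay -/

/-- Some iterate of `A` splits as a concatenation of elementary strings. -/
def Decays (A : Str) : Prop :=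
  ∃ k P, (∀ B ∈ P, Elementary B) ∧ SplitsAs (iter A k) P

theorem Elementary.decays {A : Str} (h : Elementary A) : Decays A :=
  ⟨0, [A], by simpa using h, splitsAs_singleton A⟩

theorem decays_nil : Decays [] := ⟨0, [], by simp, splitsAs_nil⟩

theorem decays_of_iter {A : Str} (k : ℕ) (h : Decays (iter A k)) : Decays A := by
  obtain ⟨m, P, hP, hs⟩ := h
  exact ⟨k + m, P, hP, by rwa [iter_add]⟩

theorem decays_of_say {A : Str} (h : Decays (say A)) : Decays A := decays_of_iter 1 h

theorem decays_append {L R : Str} (hL : Decays L) (hR : Decays R)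
    (h : ∀ n, iter (L ++ R) n = iter L n ++ iter R n) : Decays (L ++ R) := by
  obtain ⟨k, P, hP, hsP⟩ := hL
  obtain ⟨m, Q, hQ, hsQ⟩ := hR
  refine ⟨k + m, (P.map fun B => iter B m) ++ Q.map fun B => iter B k, ?_, ?_⟩
  · intro B hB
    rcases List.mem_append.1 hB with hB | hB
    · obtain ⟨B', hB', rfl⟩ := List.mem_map.1 hB
      exact (hP B' hB').iter m
    · obtain ⟨B', hB', rfl⟩ := List.mem_map.1 hB
      exact (hQ B' hB').iter k
  · rw [h]
    refine SplitsAs.append (by rw [iter_add]; exact hsP.iter m)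
      (by rw [add_comm, iter_add]; exact hsQ.iter k) fun n => ?_
    rw [← h, ← iter_add, h, ← iter_add, ← iter_add]

/-! ### Bounded pieces: strings whose runs have length at most three -/

/-- Reads `z` as a sequence of pairs `x d`, each describing a run of `x` digits `d`, and returns
the string described; a last unpaired digit is ignored. The result is `none` if two consecutive
described runs, or `prev` and the first one, have the same digit. -/
def decode : Option (Fin 3) → Str → Option Str
  | prev, x :: d :: z =>
    if prev = some d then none else (decode (some d) z).map (List.replicate x.val d ++ ·)
  | _, _ => some []

/-- Tests that no four consecutive digits are equal. -/
def noFour : Str → Bool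
  | a :: b :: c :: d :: l => !(a == b && b == c && c == d) && noFour (b :: c :: d :: l)
  | _ => true

/-- Tests whether `z` can be decoded `k` times in succession, each time starting either with
a numeral or with a described digit, without ever meeting four equal consecutive digits. -/
def admissible : ℕ → Str → Bool
  | 0, z => noFour z
  | k + 1, z => noFour z &&
      ((match decode none z with
        | some y => admissible k y
        | none => false) ||
      (match z with
        | [] => false
        | d :: z => match decode (some d) z with
          | some y => admissible k y
          | none => false))

theorem zero_notMem_decode {prev : Option (Fin 3)} {z y : Str} (hz : 0 ∉ z)
    (h : decode prev z = some y) : 0 ∉ y := by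
  induction prev, z using decode.induct generalizing y with
  | case1 x d z => simp [decode] at h
  | case2 prev x d z hd ih =>
    simp only [decode, hd, if_false, Option.map_eq_some_iff] at h
    obtain ⟨y', hy', rfl⟩ := h
    simp only [List.mem_cons, not_or] at hz
    simp only [List.mem_append, List.mem_replicate, not_or, not_and]
    exact ⟨fun _ => hz.2.1, ih hz.2.2 hy'⟩
  | case3 prev z hz' =>
    rw [decode] at h
    · obtain rfl := Option.some.inj h
      simp
    · exact hz'

theorem gBound_le (d : Fin 3) : gBound d ≤ 3 := by
  revert d
  decide

theorem gBound_cases {k : ℕ} {d : Fin 3} (h : k + 1 ≤ gBound d) :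
    base3 (k + 1) = [1] ∧ k = 0 ∨ base3 (k + 1) = [2] ∧ k = 1 ∨ base3 (k + 1) = [1, 0] := by
  have : k < 3 := h.trans (gBound_le d)
  rw [base3_eq_numeral]
  interval_cases k <;> simp [numeral]

/-- A zero-free string at the start of `say B` describes a string at the start of `B`. -/
theorem exists_decode_of_prefix {B : Str} (hB : RunsLE gBound B) {prev : Option (Fin 3)} {z : Str}
    (hprev : ∀ d ∈ prev, d ∉ B.head?) (hz : 0 ∉ z) (h : z <+: say B) :
    ∃ y, decode prev z = some y ∧ y <+: B := by
  induction B using run_induction generalizing prev z with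
  | nil =>
    obtain rfl : z = [] := by simpa using h
    exact ⟨[], by simp [decode]⟩
  | run k d B hd ih =>
    rw [runsLE_run hd] at hB
    rw [say_run k hd] at h
    have hpd : prev ≠ some d := by
      rintro rfl
      simp [List.replicate_succ] at hprev
    have step : ∀ x : Fin 3, x.val = k + 1 → z <+: x :: d :: say B →
        ∃ y, decode prev z = some y ∧ y <+: List.replicate (k + 1) d ++ B := by
      intro x hx h
      match z with
      | [] => exact ⟨[], by simp [decode]⟩
      | [_] => exact ⟨[], by simp [decode]⟩
      | a :: b :: z =>
        simp only [List.cons_prefix_cons] at h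
        obtain ⟨rfl, rfl, h⟩ := h
        simp only [List.mem_cons, not_or] at hz
        obtain ⟨y, hy, hyB⟩ := ih hB.2 (prev := some b) (by simpa using hd) hz.2.2 h
        refine ⟨List.replicate (k + 1) b ++ y, by simp [decode, hpd, hy, hx], ?_⟩
        exact (List.prefix_append_right_inj _).2 hyB
    rcases gBound_cases hB.1 with ⟨e, hk⟩ | ⟨e, hk⟩ | e
    · rw [e] at h
      exact step 1 (by simp [hk]) h
    · rw [e] at h
      exact step 2 (by simp [hk]) h
    · rw [e] at h
      match z with
      | [] => exact ⟨[], by simp [decode]⟩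
      | [_] => exact ⟨[], by simp [decode]⟩
      | a :: b :: z =>
        simp only [List.cons_append, List.cons_prefix_cons] at h
        simp [← h.2.1] at hz

/-- A zero-free string inside `say B` describes a string inside `B`, once it is known whether it
starts with a numeral or with a described digit. -/
theorem exists_decode_of_infix {B : Str} (hB : RunsLE gBound B) {z : Str} (hz : 0 ∉ z)
    (h : z <:+: say B) :
    (∃ y, decode none z = some y ∧ y <:+: B) ∨
      ∃ d z' y, z = d :: z' ∧ decode (some d) z' = some y ∧ y <:+: B := by
  rw [List.infix_iff_prefix_suffix] at h
  obtain ⟨t, hzt, ht⟩ := h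
  induction B using run_induction with
  | nil =>
    obtain rfl : t = [] := by simpa using ht
    obtain rfl : z = [] := by simpa using hzt
    exact Or.inl ⟨[], by simp [decode]⟩
  | run k d B hd ih =>
    have hwhole : t = say (List.replicate (k + 1) d ++ B) →
        ∃ y, decode none z = some y ∧ y <:+: List.replicate (k + 1) d ++ B := by
      rintro rfl
      obtain ⟨y, h1, h2⟩ := exists_decode_of_prefix hB (prev := none) (by simp) hz hzt
      exact ⟨y, h1, h2.isInfix⟩
    rw [runsLE_run hd] at hB
    rw [say_run k hd] at ht hwhole
    have htail : t <:+ d :: say B →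
        (∃ y, decode none z = some y ∧ y <:+: List.replicate (k + 1) d ++ B) ∨
        ∃ e z' y, z = e :: z' ∧ decode (some e) z' = some y ∧
          y <:+: List.replicate (k + 1) d ++ B := by
      intro ht
      have hin : ∀ {y : Str}, y <:+: B → y <:+: List.replicate (k + 1) d ++ B :=
        fun hy => hy.trans (List.suffix_append _ _).isInfix
      rcases List.suffix_cons_iff.1 ht with rfl | ht
      · match z with
        | [] => exact Or.inl ⟨[], by simp [decode]⟩
        | a :: z =>
          simp only [List.cons_prefix_cons] at hzt
          obtain ⟨rfl, hzt⟩ := hzt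
          simp only [List.mem_cons, not_or] at hz
          obtain ⟨y, h1, h2⟩ := exists_decode_of_prefix hB.2 (prev := some a) (by simpa using hd)
            hz.2 hzt
          exact Or.inr ⟨a, z, y, rfl, h1, hin h2.isInfix⟩
      · rcases ih hB.2 ht with ⟨y, h1, h2⟩ | ⟨e, z', y, h1, h2, h3⟩
        · exact Or.inl ⟨y, h1, hin h2⟩
        · exact Or.inr ⟨e, z', y, h1, h2, hin h3⟩
    rcases gBound_cases hB.1 with ⟨e, -⟩ | ⟨e, -⟩ | e
    · rw [e] at ht hwhole
      rcases List.suffix_cons_iff.1 ht with ht | ht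
      · exact Or.inl (hwhole ht)
      · exact htail ht
    · rw [e] at ht hwhole
      rcases List.suffix_cons_iff.1 ht with ht | ht
      · exact Or.inl (hwhole ht)
      · exact htail ht
    · rw [e] at ht hwhole
      rcases List.suffix_cons_iff.1 ht with ht | ht
      · exact Or.inl (hwhole ht)
      · rcases List.suffix_cons_iff.1 ht with rfl | ht
        · match z with
          | [] => exact Or.inl ⟨[], by simp [decode]⟩
          | a :: z => simp [(List.cons_prefix_cons.1 hzt).1] at hz
        · exact htail ht

theorem noFour_of_runsLE {z : Str} (h : RunsLE gBound z) : noFour z = true := by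
  induction z using noFour.induct with
  | case1 a b c d l ih =>
    rw [noFour, ih (h.infix (List.suffix_cons _ _).isInfix)]
    simp only [Bool.and_true, Bool.not_eq_true', Bool.and_eq_false_iff, beq_eq_false_iff_ne]
    by_contra! hcon
    obtain ⟨⟨rfl, rfl⟩, rfl⟩ := hcon
    have h4 : 4 ≤ gBound a := runsLE_iff.1 h 4 a ⟨[], l, by simp [List.replicate_succ]⟩
    exact absurd (h4.trans (gBound_le a)) (by norm_num)
  | case2 z hz =>
    rw [noFour]
    exact hz

theorem admissible_of_infix {A : Str} (hA : RunsLE gBound A) {k : ℕ} {z : Str} (hz : 0 ∉ z)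
    (h : z <:+: iter A k) : admissible k z = true := by
  have h4 : noFour z = true := noFour_of_runsLE ((hA.iter_gBound k).infix h)
  induction k generalizing z with
  | zero => exact h4
  | succ k ih =>
    rw [iter_succ'] at h
    have next : ∀ {y : Str}, 0 ∉ y → y <:+: iter A k → admissible k y = true := fun hy h =>
      ih hy h (noFour_of_runsLE ((hA.iter_gBound k).infix h))
    rcases exists_decode_of_infix (hA.iter_gBound k) hz h with ⟨y, h1, h2⟩ | ⟨d, z, y, rfl, h1, h2⟩
    · simp [admissible, h4, h1, next (zero_notMem_decode hz h1) h2]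
    · simp only [List.mem_cons, not_or] at hz
      simp [admissible, h4, h1, next (zero_notMem_decode hz.2 h1) h2]

/-- Cuts a string after each `0`; `acc` is the part of the current piece that was already read. -/
def cut (acc : Str) : Str → List Str
  | [] => [acc]
  | d :: l => if d = 0 then (acc ++ [d]) :: cut [] l else cut (acc ++ [d]) l

/-- Tests that no two consecutive digits are `0`. -/
def noZeroZero : Str → Bool
  | a :: b :: l => !(a == 0 && b == 0) && noZeroZero (b :: l)
  | _ => true

theorem noZeroZero_cons {a : Fin 3} {l : Str} (h : noZeroZero (a :: l) = true) :
    noZeroZero l = true ∧ (a = 0 → 0 ∉ l.head?) := by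
  cases l with
  | nil => simp [noZeroZero]
  | cons b l =>
    simp only [noZeroZero, Bool.and_eq_true, Bool.not_eq_true', Bool.and_eq_false_iff,
      beq_eq_false_iff_ne] at h
    refine ⟨h.2, fun ha hb => ?_⟩
    simp only [List.head?_cons, Option.mem_some_iff] at hb
    exact h.1.elim (fun h => h ha) (fun h => h hb)

theorem noZeroZero_of_runsLE {z : Str} (h : RunsLE gBound z) : noZeroZero z = true := by
  induction z using noZeroZero.induct with
  | case1 a b l ih =>
    rw [noZeroZero, ih (h.infix (List.suffix_cons _ _).isInfix)]
    simp only [Bool.and_true, Bool.not_eq_true', Bool.and_eq_false_iff, beq_eq_false_iff_ne]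
    by_contra! hcon
    obtain ⟨rfl, rfl⟩ := hcon
    have h2 : 2 ≤ gBound 0 := runsLE_iff.1 h 2 0 ⟨[], l, by simp [List.replicate_succ]⟩
    revert h2
    decide
  | case2 z hz =>
    rw [noZeroZero]
    exact hz

theorem decays_of_cut {acc l : Str} (hl : noZeroZero l = true)
    (h : ∀ p ∈ cut acc l, Decays p) : Decays (acc ++ l) := by
  induction l generalizing acc with
  | nil => simpa [cut] using h
  | cons d l ih =>
    obtain ⟨hl', hd⟩ := noZeroZero_cons hl
    rw [List.append_cons]
    by_cases h0 : d = 0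
    · simp only [cut, h0, if_true, List.forall_mem_cons] at h
      subst h0
      exact decays_append h.1 (ih hl' h.2) (iter_append_of_zero (by simp) (hd rfl))
    · simp only [cut, h0, if_false] at h
      exact ih hl' h

theorem eq_of_mem_cut {acc l p : Str} (hacc : 0 ∉ acc) (hp : p ∈ cut acc l) :
    ∃ w, 0 ∉ w ∧ w <:+: acc ++ l ∧ (p = w ∨ p = w ++ [0]) := by
  induction l generalizing acc with
  | nil =>
    obtain rfl : p = acc := by simpa [cut] using hp
    exact ⟨p, hacc, by simp, Or.inl rfl⟩
  | cons d l ih =>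
    by_cases h0 : d = 0
    · simp only [cut, h0, if_true, List.mem_cons] at hp
      rcases hp with rfl | hp
      · exact ⟨acc, hacc, (List.prefix_append _ _).isInfix, Or.inr rfl⟩
      · obtain ⟨w, h1, h2, h3⟩ := ih (by simp) hp
        refine ⟨w, h1, ?_, h3⟩
        rw [List.append_cons]
        exact h2.trans (List.suffix_append _ _).isInfix
    · simp only [cut, h0, if_false] at hp
      rw [List.append_cons]
      exact ih (by simp [hacc, Ne.symm h0]) hp

/-- The empty string, the neutrino `22`, and growing strings. -/
def atoms : List Str :=
  [[], [2, 2], [1, 0], [1, 1, 1, 0], [2, 1, 1, 0], [2, 2, 1, 1, 0], [1, 1, 0], [1, 2, 2, 1, 1, 0],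
    [2, 2, 2, 1, 1, 0], [1, 1, 2, 2, 2, 1, 1, 0], [2, 2, 1, 0], [2, 1, 1], [2, 1, 1, 2, 2],
    [2, 2, 1, 1, 2], [2, 2, 1, 1, 2, 1, 1, 1, 0], [2, 2, 1, 1, 2, 1, 0], [2, 1, 1, 2, 1, 0],
    [1, 1, 1, 2, 1, 0], [1, 2, 1, 1, 1, 0], [2, 1, 1, 2, 2, 1, 0], [1, 2, 2, 1, 2, 2, 1, 0]]

theorem decays_of_mem_atoms {w : Str} (h : w ∈ atoms) : Decays w := by
  have key : ∀ w ∈ atoms, w = [] ∨ Elementary w := by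
    simp [atoms, Elementary, neutrinos, grows_E, grows_M, grows_D, grows_B, grows_U, grows_S,
      grows_T, grows_C, grows_2210, grows_211, grows_21122, grows_22112, grows_221121110,
      grows_2211210, grows_211210, grows_111210, grows_121110, grows_2112210, grows_12212210]
  rcases key w h with rfl | h
  · exact decays_nil
  · exact h.decays

/-- Tests whether `w` reaches the list `atoms` when it is developed for at most the given number
of steps, being cut after each `0`. -/
def reduces : ℕ → Str → Bool
  | 0, w => atoms.contains w
  | n + 1, w => atoms.contains w ||
      (noZeroZero (sayC w) && (cut [] (sayC w)).all (reduces n))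

theorem decays_of_reduces {n : ℕ} {w : Str} (h : reduces n w = true) : Decays w := by
  induction n generalizing w with
  | zero => exact decays_of_mem_atoms (by simpa [reduces] using h)
  | succ n ih =>
    simp only [reduces, Bool.or_eq_true, Bool.and_eq_true, List.contains_iff_mem,
      List.all_eq_true] at h
    rcases h with h | ⟨h1, h2⟩
    · exact decays_of_mem_atoms h
    · refine decays_of_say ?_
      rw [say_eq_sayC]
      exact decays_of_cut (acc := []) h1 fun p hp => ih (h2 p hp)

/-- Explores the zero-free strings that extend `z` by at most `n` digits: tests that all
admissible ones are extended by less than `n` digits, and that each of them reduces to `atoms`,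
with or without a `0` at the end. -/
def searchTree : ℕ → Str → Bool
  | 0, z => !admissible 3 z
  | n + 1, z => !admissible 3 z ||
    (reduces 12 z && reduces 12 (z ++ [0]) && searchTree n (z ++ [1]) && searchTree n (z ++ [2]))

theorem decays_of_searchTree {n : ℕ} {z w : Str} (h : searchTree n z = true) (hw : 0 ∉ w)
    (hadm : ∀ v, v <+: z ++ w → admissible 3 v = true) :
    Decays (z ++ w) ∧ Decays (z ++ w ++ [0]) := by
  have hz := hadm z (List.prefix_append _ _)
  induction n generalizing z w with
  | zero => simp [searchTree, hz] at h
  | succ n ih =>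
    simp only [searchTree, hz, Bool.not_true, Bool.false_or, Bool.and_eq_true] at h
    obtain ⟨⟨⟨h1, h2⟩, h3⟩, h4⟩ := h
    match w with
    | [] =>
      rw [List.append_nil]
      exact ⟨decays_of_reduces h1, decays_of_reduces h2⟩
    | a :: w =>
      simp only [List.mem_cons, not_or] at hw
      rw [List.append_cons] at hadm ⊢
      have hs : searchTree n (z ++ [a]) = true := by
        match a with
        | 0 => exact absurd rfl hw.1
        | 1 => exact h3
        | 2 => exact h4
      exact ih hs hw.2 hadm (hadm _ (List.prefix_append _ _))

/-- Admissible strings have fewer than `19` digits, and all of them reduce. -/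
theorem searchTree_nil : searchTree 19 [] = true := by decide +kernel

/-- After three steps the pieces between zeros belong to a finite list. -/
theorem decays_of_gBound {A : Str} (hA : RunsLE gBound A) : Decays A := by
  refine decays_of_iter 3 ?_
  rw [← List.nil_append (iter A 3)]
  refine decays_of_cut (noZeroZero_of_runsLE (hA.iter_gBound 3)) fun p hp => ?_
  obtain ⟨w, h0, hw, hpw⟩ := eq_of_mem_cut (by simp) hp
  have := decays_of_searchTree searchTree_nil h0 fun v hv =>
    admissible_of_infix hA (fun h => h0 (hv.subset h)) (hv.isInfix.trans hw)
  rcases hpw with rfl | rfl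
  · exact this.1
  · exact this.2

/-! ### Runs of four ones and the decay of every string -/

theorem base3_one : base3 1 = [1] := by rw [base3_eq_numeral]; rfl
theorem base3_two : base3 2 = [2] := by rw [base3_eq_numeral]; rfl
theorem base3_three : base3 3 = [1, 0] := by rw [base3_eq_numeral]; rfl
theorem base3_four : base3 4 = [1, 1] := by rw [base3_eq_numeral]; rfl

/-- The two beginnings `111` and `10` alternate or persist, so that the first digit stays `1`. -/
theorem prefix_say {A : Str} (hA : RunsLE hBound A) (h : [1, 1, 1] <+: A ∨ [1, 0] <+: A) :
    [1, 1, 1] <+: say A ∨ [1, 0] <+: say A := by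
  induction A using run_induction with
  | nil => simp at h
  | run k d B hd _ =>
    rw [runsLE_run hd] at hA
    rw [say_run k hd]
    obtain rfl : d = 1 := by
      rcases h with ⟨t, h⟩ | ⟨t, h⟩ <;>
      · have := congrArg List.head? h
        simpa [List.replicate_succ, eq_comm] using this
    have hk : k + 1 ≤ 4 := hA.1
    match k with
    | 0 =>
      left
      rw [base3_one]
      induction B using run_induction with
      | nil => simp at h
      | run j e B he _ =>
        rw [runsLE_run he] at hA
        obtain rfl : e = 0 := by
          rcases h with ⟨t, h⟩ | ⟨t, h⟩
          · simp only [List.replicate_succ, List.replicate_zero, List.cons_append, List.nil_append,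
              List.cons.injEq] at h
            simp [List.replicate_succ, ← h.2.1] at hd
          · simp only [List.replicate_succ, List.replicate_zero, List.cons_append, List.nil_append,
              List.cons.injEq] at h
            exact h.2.1.symm
        obtain rfl : j = 0 := by
          have : j + 1 ≤ 1 := hA.2.1
          omega
        rw [say_run 0 he, base3_one]
        simp
    | 1 =>
      rcases h with ⟨t, h⟩ | ⟨t, h⟩
      · simp only [List.replicate_succ, List.replicate_zero, List.cons_append, List.nil_append,
          List.cons.injEq, true_and] at h
        simp [← h] at hd
      · simp [List.replicate_succ] at h
    | 2 =>
      right
      rw [base3_three]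
      simp
    | 3 =>
      left
      rw [base3_four]
      simp

theorem head?_iter {A : Str} (hA : RunsLE hBound A) (h : [1, 1, 1] <+: A) (n : ℕ) :
    (iter A n).head? = some 1 := by
  have key : [1, 1, 1] <+: iter A n ∨ [1, 0] <+: iter A n := by
    induction n with
    | zero => exact Or.inl h
    | succ n ih =>
      rw [iter_succ']
      exact prefix_say (hA.iter_hBound n) ih
  rcases key with ⟨t, ht⟩ | ⟨t, ht⟩ <;> simp [← ht]

theorem iter_append_of_ones {L R : Str} (hL : 1 ∉ L.getLast?) (hR : RunsLE hBound R)
    (h : [1, 1, 1] <+: R) (n : ℕ) : iter (L ++ R) n = iter L n ++ iter R n := by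
  refine iter_append (fun n x hx => ?_) n
  rw [head?_iter hR h n]
  intro h1
  obtain rfl : 1 = x := by simpa using h1
  exact hL hx

theorem say_four_ones {R : Str} (h : 1 ∉ R.head?) :
    say ([1, 1, 1, 1] ++ R) = [1, 1, 1] ++ say R := by
  have := say_run (d := 1) 3 h
  rw [base3_four] at this
  simpa [List.replicate_succ] using this

theorem decays_11110_append {B : Str} (hB : RunsLE gBound B) (h : 0 ∉ B.head?) :
    Decays ([1, 1, 1, 1, 0] ++ B) :=
  decays_append (Elementary.decays (Or.inl (by simp [neutrinos]))) (decays_of_gBound hB)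
    (iter_append_of_zero (by simp) h)

/-- A run of four ones followed by two or three twos disappears or becomes part of the neutrino
`11110`. -/
theorem decays_1111_append_twos {k : ℕ} {B : Str}
    (hB : RunsLE gBound (List.replicate (k + 2) 2 ++ B)) (h2 : 2 ∉ B.head?) :
    Decays ([1, 1, 1, 1] ++ (List.replicate (k + 2) 2 ++ B)) := by
  have hs := hB.say_gBound
  rw [runsLE_run h2] at hB
  have hk : k + 2 ≤ 3 := hB.1
  refine decays_of_say ?_
  rw [say_four_ones (by simp [List.replicate_succ])]
  rw [say_run _ h2] at hs ⊢
  match k with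
  | 0 =>
    rw [base3_two] at *
    refine decays_of_gBound ((runsLE_run (k := 2) (d := 1) ?_).2 ⟨by decide, hs⟩)
    simp
  | 1 =>
    rw [base3_three] at *
    exact decays_11110_append (hs.infix ⟨[1, 0], [], by simp⟩) (by simp)

/-- The neutrino `11110` or `11112` splits off, unless a run of at least two twos follows `1111`
at some step. -/
theorem decays_1111_append {R : Str} (hR : RunsLE gBound R) (h1 : 1 ∉ R.head?) :
    Decays ([1, 1, 1, 1] ++ R) := by
  induction R using run_induction with
  | nil =>
    refine decays_of_say (decays_of_gBound ?_)
    rw [say_four_ones h1]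
    exact (runsLE_run (k := 2) (d := 1) (B := []) (by simp)).2 ⟨by decide, by simp [RunsLE, runs]⟩
  | run k d B hd _ =>
    have hR' := hR
    rw [runsLE_run hd] at hR
    match d, k with
    | 0, 0 => exact decays_11110_append hR.2 hd
    | 0, k + 1 => exact absurd hR.1 (by simp)
    | 1, _ => simp [List.replicate_succ] at h1
    | 2, k + 1 => exact decays_1111_append_twos hR' hd
    | 2, 0 =>
      by_cases hn : ∀ n, 2 ∉ (iter B n).head?
      · exact decays_append (L := [1, 1, 1, 1, 2])
          (Elementary.decays (Or.inl (by simp [neutrinos]))) (decays_of_gBound hR.2)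
          (iter_append fun n x hx => by
            obtain rfl : 2 = x := by simpa using hx
            exact hn n)
      · -- at the first step `n` at which a `2` follows `11112`, the run of twos becomes longer
        push Not at hn
        classical
        have hlt := fun m => Nat.find_min hn (m := m)
        have hfind := Nat.find_spec hn
        generalize Nat.find hn = n at hlt hfind
        have e : iter ([1, 1, 1, 1, 2] ++ B) n = [1, 1, 1, 1, 2] ++ iter B n := by
          rw [iter_append_of_lt, iter_eq_self (say_neutrino (by simp [neutrinos]))]
          intro m hm x hx
          obtain rfl : 2 = x := by simpa using hx
          exact hlt m hm
        refine decays_of_iter (A := [1, 1, 1, 1, 2] ++ B) n ?_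
        rw [e]
        have hn := hR.2.iter_gBound n
        have hrun : RunsLE hBound ([1, 1, 1, 1, 2] ++ iter B n) := by
          rw [← e]
          refine RunsLE.iter_hBound ?_ n
          refine (runsLE_run (k := 3) (d := 1) (B := 2 :: B) (by simp)).2 ⟨by decide, ?_⟩
          exact hR'.mono (by decide)
        clear e hlt
        generalize iter B n = C at *
        induction C using run_induction with
        | nil => simp at hfind
        | run j e C he _ =>
          obtain rfl : e = 2 := by simpa [List.replicate_succ] using hfind
          refine decays_1111_append_twos (k := j) (B := C) ?_ he
          refine (runsLE_run (k := j + 1) he).2 ⟨?_, ((runsLE_run he).1 hn).2⟩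
          exact runsLE_iff.1 hrun (j + 2) 2 ⟨[1, 1, 1, 1], C, by simp [List.replicate_succ]⟩

theorem decays_of_hBound {A : Str} (hA : RunsLE hBound A) : Decays A := by
  induction hlen : A.length using Nat.strong_induction_on generalizing A with
  | _ N ih =>
    subst hlen
    have gBound_of : ∀ B : Str, B <:+: A → ¬ [1, 1, 1, 1] <:+: B → RunsLE gBound B := by
      intro B hB h4
      refine runsLE_iff.2 fun m d hm => ?_
      have hm' := runsLE_iff.1 (hA.infix hB) m d hm
      match d with
      | 0 => exact hm'
      | 2 => exact hm'
      | 1 =>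
        by_contra hlt
        exact h4 ((prefix_replicate_of_le (m := 4) (d := 1) (not_le.1 hlt)).isInfix.trans hm)
    by_cases hex : ∃ L R, L ≠ [] ∧ A = L ++ ([1, 1, 1, 1] ++ R)
    · obtain ⟨L, R, hL, rfl⟩ := hex
      have hLpos := List.length_pos_iff.2 hL
      have h1 : RunsLE hBound L := hA.infix (List.prefix_append _ _).isInfix
      have h2 : RunsLE hBound ([1, 1, 1, 1] ++ R) := hA.infix (List.suffix_append _ _).isInfix
      refine decays_append (ih _ (by simp) h1 rfl) (ih _ (by simpa using hLpos) h2 rfl)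
        (iter_append_of_ones ?_ h2 (by simp))
      intro hlast
      obtain ⟨L', rfl⟩ := List.getLast?_eq_some_iff.1 hlast
      have : 5 ≤ 4 := runsLE_iff.1 hA 5 1 ⟨L', R, by simp [List.replicate_succ]⟩
      omega
    · by_cases h4 : [1, 1, 1, 1] <:+: A
      · obtain ⟨L, R, rfl⟩ := h4
        obtain rfl : L = [] := by
          by_contra hL
          exact hex ⟨L, R, hL, by simp⟩
        rw [List.nil_append] at *
        refine decays_1111_append (gBound_of R (List.suffix_append _ _).isInfix ?_) ?_
        · rintro ⟨L', R', rfl⟩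
          exact hex ⟨[1, 1, 1, 1] ++ L', R', by simp, by simp⟩
        · intro hhead
          obtain ⟨R', rfl⟩ := List.head?_eq_some_iff.1 hhead
          have : 5 ≤ 4 := runsLE_iff.1 hA 5 1 ⟨[], R', by simp [List.replicate_succ]⟩
          omega
      · exact decays_of_gBound (gBound_of A (List.infix_refl A) h4)

/-- Every string eventually splits into neutrinos and growing strings. -/
theorem decays (A : Str) : Decays A := by
  obtain ⟨n, hn⟩ := exists_iter_hBound A
  exact decays_of_iter n (decays_of_hBound hn)

/-! ### The transition matrix -/

set_option maxHeartbeats 4000000 in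
/-- The characteristic polynomial of the transition matrix, in determinant form. -/
theorem det_sub_transitionMatrix {R : Type*} [CommRing R] (x : R) : Matrix.det
    !![x, -1, 0, 0, 0, 0, -1, 0;
       -1, x, 0, 0, 0, 0, 0, 0;
       0, 0, x, 0, -1, 0, 0, -1;
       0, 0, 0, x, 0, 0, -1, -1;
       0, -1, 0, 0, x, 0, 0, 0;
       0, 0, -1, 0, 0, x, 0, 0;
       0, 0, 0, -1, 0, 0, x, 0;
       0, 0, 0, 0, 0, -1, 0, x] = (x ^ 3 - x - 1) * (x ^ 5 - x ^ 3 + 1) := by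
  simp [Matrix.det_succ_row_zero, Fin.sum_univ_succ, Fin.succAbove]
  ring

open Polynomial in
theorem charpoly_transitionMatrix :
    (transitionMatrix.map (Nat.cast : ℕ → ℝ)).charpoly =
      (X ^ 3 - X - 1) * (X ^ 5 - X ^ 3 + 1) := by
  rw [← det_sub_transitionMatrix, Matrix.charpoly]
  congr 1
  ext1 i j
  fin_cases i <;> fin_cases j <;> simp [transitionMatrix]

open Polynomial in
theorem rootMultiplicity_charpoly :
    (transitionMatrix.map (Nat.cast : ℕ → ℝ)).charpoly.rootMultiplicity ρ = 1 := by
  have h0 := (Matrix.charpoly_monic (transitionMatrix.map (Nat.cast : ℕ → ℝ))).ne_zero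
  have h3 := plastic_cube
  have hge := plastic_ge
  refine le_antisymm (not_lt.1 fun h => ?_) ((rootMultiplicity_pos h0).2 ?_)
  · have h1 := ((one_lt_rootMultiplicity_iff_isRoot h0).1 h).2
    rw [charpoly_transitionMatrix] at h1
    simp [IsRoot] at h1
    have e : ρ ^ 3 - ρ - 1 = 0 := by linarith
    rw [e, zero_mul, add_zero] at h1
    have h5 : ρ ^ 5 = ρ ^ 3 + ρ ^ 2 := by linear_combination ρ ^ 2 * h3
    have h2 : 1 < ρ ^ 2 := one_lt_pow₀ one_lt_plastic (by norm_num)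
    rcases mul_eq_zero.1 h1 with h | h <;> linarith
  · rw [charpoly_transitionMatrix]
    simp only [IsRoot, eval_mul, eval_sub, eval_pow, eval_X, eval_one]
    rw [h3]
    ring

/-- The roots of the second factor of the characteristic polynomial have modulus less
than `ρ`, since `ρ ^ 3 * (ρ ^ 2 - 1) = ρ ^ 2 > 1`. -/
theorem norm_lt_of_quintic {z : ℂ} (hz : z ^ 5 - z ^ 3 + 1 = 0) : ‖z‖ < ρ := by
  by_contra! h
  have h1 : z ^ 3 * (z ^ 2 - 1) = -1 := by linear_combination hz
  have h2 : ‖z‖ ^ 3 * ‖z ^ 2 - 1‖ = 1 := by rw [← norm_pow, ← norm_mul, h1]; simp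
  have h3 : ‖z‖ ^ 2 - 1 ≤ ‖z ^ 2 - 1‖ := by
    have := norm_sub_norm_le (z ^ 2) 1
    rwa [norm_pow, norm_one] at this
  have hρ := one_lt_plastic
  have h4 : ρ ^ 3 ≤ ‖z‖ ^ 3 := by gcongr
  have h5 : ρ ^ 2 ≤ ‖z‖ ^ 2 := by gcongr
  have h6 : 1 < ρ ^ 2 := one_lt_pow₀ hρ (by norm_num)
  have h7 : ρ ^ 3 * (ρ ^ 2 - 1) ≤ ‖z‖ ^ 3 * ‖z ^ 2 - 1‖ := by
    gcongr
    linarith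
  have h8 : ρ ^ 3 * (ρ ^ 2 - 1) = ρ ^ 2 := by
    linear_combination (ρ ^ 2) * plastic_cube
  linarith

/-- The two complex roots of `x ^ 3 - x - 1` have modulus less than `ρ`, as the square of their
modulus is `1 / ρ`. -/
theorem norm_lt_of_cubic {z : ℂ} (hz : z ^ 3 - z - 1 = 0) (hne : z ≠ ρ) : ‖z‖ < ρ := by
  have h3 : (ρ : ℂ) ^ 3 = ρ + 1 := by exact_mod_cast plastic_cube
  have h1 : (z - ρ) * (z ^ 2 + ρ * z + (ρ ^ 2 - 1)) = 0 := by linear_combination hz - h3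
  have h2 := (mul_eq_zero.1 h1).resolve_left (sub_ne_zero.2 hne)
  have hge := plastic_ge
  have hlt := plastic_lt
  obtain ⟨x, y⟩ := z
  have hre := congrArg Complex.re h2
  have him := congrArg Complex.im h2
  simp [pow_two] at hre him
  have hy : y ≠ 0 := by
    rintro rfl
    nlinarith [sq_nonneg (2 * x + ρ)]
  have hx : 2 * x + ρ = 0 := by
    have : y * (2 * x + ρ) = 0 := by linarith
    exact (mul_eq_zero.1 this).resolve_left hy
  have hsq : ‖(⟨x, y⟩ : ℂ)‖ ^ 2 < ρ ^ 2 := by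
    rw [Complex.sq_norm, Complex.normSq_mk]
    have : ρ = -2 * x := by linarith
    nlinarith
  exact lt_of_pow_lt_pow_left₀ 2 plastic_pos.le hsq

theorem norm_lt_of_hasEigenvalue {z : ℂ}
    (hz : Module.End.HasEigenvalue (Matrix.toLin'
      ((transitionMatrix.map (Nat.cast : ℕ → ℝ)).map Complex.ofReal)) z) (hne : z ≠ (ρ : ℂ)) :
    ‖z‖ < ρ := by
  obtain ⟨v, hv⟩ := hz.exists_hasEigenvector
  have hv1 := hv.apply_eq_smul
  rw [Matrix.toLin'_apply] at hv1
  have key : ∀ i, _ := fun i => congrFun hv1 i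
  have e0 := key 0
  have e1 := key 1
  have e2 := key 2
  have e3 := key 3
  have e4 := key 4
  have e5 := key 5
  have e6 := key 6
  have e7 := key 7
  simp [transitionMatrix, Matrix.mulVec, dotProduct, Fin.sum_univ_succ] at e0 e1 e2 e3 e4 e5 e6 e7
  have h6 : v 6 = (z ^ 3 - z) * v 4 := by linear_combination e0 + z * e1 + (z ^ 2 - 1) * e4
  have h3 : v 3 = (z ^ 4 - z ^ 2) * v 4 := by linear_combination e6 + z * h6
  have h7 : v 7 = (z ^ 5 - 2 * z ^ 3 + z) * v 4 := by linear_combination e3 + z * h3 - h6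
  have h5 : v 5 = z * (z ^ 5 - 2 * z ^ 3 + z) * v 4 := by linear_combination e7 + z * h7
  have h2 : v 2 = z ^ 2 * (z ^ 5 - 2 * z ^ 3 + z) * v 4 := by linear_combination e5 + z * h5
  have hchar : (z ^ 3 - z - 1) * ((z ^ 5 - z ^ 3 + 1) * v 4) = 0 := by
    linear_combination -e2 - z * h2 + h7
  have h4 : v 4 ≠ 0 := by
    intro h4
    rw [h4, mul_zero] at h2 h3 h5 h6 h7 e4
    rw [e4, mul_zero] at e1
    refine hv.2 (funext fun i => ?_)
    fin_cases i <;> assumption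
  rcases mul_eq_zero.1 hchar with h | h
  · exact norm_lt_of_cubic h hne
  · exact norm_lt_of_quintic ((mul_eq_zero.1 h).resolve_right h4)

theorem mulVec_transitionMatrix :
    (transitionMatrix.map (Nat.cast : ℕ → ℝ)).mulVec ![ρ ^ 2, ρ, ρ, ρ, 1, 1, 1, ρ ^ 2 - 1] =
      ρ • ![ρ ^ 2, ρ, ρ, ρ, 1, 1, 1, ρ ^ 2 - 1] := by
  have h3 := plastic_cube
  ext i
  fin_cases i <;>
    simp [transitionMatrix, Matrix.mulVec, dotProduct, Fin.sum_univ_succ] <;> linarith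

theorem isPerronFrobeniusEigenvalue_plastic :
    IsPerronFrobeniusEigenvalue (transitionMatrix.map (Nat.cast : ℕ → ℝ)) ρ := by
  refine ⟨plastic_pos, ⟨_, fun i => ?_, mulVec_transitionMatrix⟩, rootMultiplicity_charpoly,
    fun z hz hne => norm_lt_of_hasEigenvalue hz hne⟩
  have h0 := plastic_pos
  have h1 : 1 < ρ ^ 2 := one_lt_pow₀ one_lt_plastic (by norm_num)
  fin_cases i <;> simp <;>
    first | positivity | exact one_lt_plastic | exact one_lt_plastic.trans_le (le_abs_self ρ)

theorem isFermionTransitionMatrix_transitionMatrix :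
    IsFermionTransitionMatrix transitionMatrix := by
  have key : ∀ j, ∃ w : List (Fin 8), (sayC^[1] (fermion j) == (w.map fermion).flatten &&
      zeroSplit (w.map fermion)) = true ∧ ∀ i, w.count i = transitionMatrix i j := fun j =>
    match j with
    | 0 => ⟨[1], by decide⟩
    | 1 => ⟨[0, 4], by decide⟩
    | 2 => ⟨[5], by decide⟩
    | 3 => ⟨[6], by decide⟩
    | 4 => ⟨[2], by decide⟩
    | 5 => ⟨[7], by decide⟩
    | 6 => ⟨[0, 3], by decide⟩
    | 7 => ⟨[2, 3], by decide⟩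
  intro j
  obtain ⟨w, h1, h2⟩ := key j
  exact ⟨w, splitsAs_iter_of_check h1, h2⟩

/-! ### The growth of the iterates -/

/-- A string none of whose iterates splits into neutrinos decays into elementary strings of which
at least one grows. -/
theorem grows_of_not_splitsIntoNeutrinos {A : Str}
    (h : ∀ k, ¬ SplitsIntoNeutrinos (iter A k)) : Grows A := by
  obtain ⟨k, P, hP, hs⟩ := decays A
  refine (grows_iter_iff k).1 (grows_of_splitsAs hs hP ?_)
  by_contra! hno
  exact h k ⟨P, fun B hB => (hP B hB).resolve_right (hno B hB), hs⟩

theorem Grows.tendsto_ratio {A : Str} (h : Grows A) :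
    Tendsto (fun n : ℕ => ((iter A (n + 1)).length : ℝ) / ((iter A n).length : ℝ)) atTop
      (𝓝 ρ) := by
  obtain ⟨c, hc, h⟩ := h
  have h1 := ((hasRate_shift 1).2 h).div h hc.ne'
  rw [pow_one, mul_div_assoc, div_self hc.ne', mul_one] at h1
  refine h1.congr fun n => ?_
  have hn : ρ ^ n ≠ 0 := (pow_pos plastic_pos n).ne'
  exact div_div_div_cancel_right₀ hn _ _

end LookAndSay

theorem mainTheorem4 :
    ∃ lam : ℝ,
      (∀ x : ℝ, x ^ 3 - x - 1 = 0 ↔ x = lam) ∧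
      (1.3247 ≤ lam ∧ lam < 1.3248) ∧
      LookAndSay.IsFermionTransitionMatrix LookAndSay.transitionMatrix ∧
      LookAndSay.IsPerronFrobeniusEigenvalue
        (LookAndSay.transitionMatrix.map (Nat.cast : ℕ → ℝ)) lam ∧
      ∀ A : LookAndSay.Str,
        (∀ k : ℕ, ¬ LookAndSay.SplitsIntoNeutrinos (LookAndSay.iter A k)) →
        Filter.Tendsto
          (fun n : ℕ => ((LookAndSay.iter A (n + 1)).length : ℝ) /
            ((LookAndSay.iter A n).length : ℝ))
          Filter.atTop (nhds lam) :=
  ⟨LookAndSay.plastic, LookAndSay.cubic_eq_zero_iff,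
    ⟨LookAndSay.plastic_ge, LookAndSay.plastic_lt⟩,
    LookAndSay.isFermionTransitionMatrix_transitionMatrix,
    LookAndSay.isPerronFrobeniusEigenvalue_plastic,
    fun _ hA => (LookAndSay.grows_of_not_splitsIntoNeutrinos hA).tendsto_ratio⟩
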